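/- Let $\mathbb{D}$ be the open unit disc and $H^2=H^2(\mathbb{D})$ the Hilbert space of functions $f(z)=\sum_{n\ge 0}a_nz^n$ on $\mathbb{D}$ with $\|f\|^2=\sum_{n\ge0}|a_n|^2<\infty$. Let $S$ be the shift $(Sf)(z)=zf(z)$ on $H^2$ and $S^*$ its adjoint, $(S^*f)(z)=(f(z)-f(0))/z$. A subspace $M\subseteq H^2$ is called nearly $S^*$-invariant if, for every $f\in H^2$, $Sf\in M$ implies $f\in M$. An inner function is a bounded analytic function $u$ on $\mathbb{D}$ whose radial limits exist and have modulus $1$ at almost every point of the unit circle; its model space is $K_u=H^2\ominus uH^2$. Theorem. Let $g$ be a bounded analytic function on $\mathbb{D}$ (that is, $g\in H^\infty(\mathbb{D})$) with $g(0)\neq 0$, and let $\theta$ be a non-constant inner function. Then the closure $\overline{gK_\theta}$ in $H^2$ of $gK_\theta=\{gk: k\in K_\theta\}$ is nearly $S^*$-invariant. Moreover, there are an $S^*$-invariant subspace $K\subseteq H^2$, which is either a model space $K_u$ with $u$ inner or $H^2$ itself, and a function $h\in H^2$ such that $hk\in H^2$ and $\|hk\|=\|k\|$ for every $k\in K$,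 and $$\overline{gK_\theta}=hK=\{hk: k\in K\}.$$ -/

import Mathlib

open Complex.UnitDisc Topology Filter

noncomputable section

namespace Hardy

/-- The square-summable complex sequences `(a₀, a₁, a₂, …)`. -/
abbrev Seq : Type := lp (fun _ : ℕ => ℂ) 2

/-- The vector space of functions `f` on the open unit disc of the form `f(z) = ∑ aₙ zⁿ` with
`∑ |aₙ|² < ∞`. -/
def hardySubmodule : Submodule ℂ (𝔻 → ℂ) where
  carrier := {f | ∃ a : Seq, ∀ z : 𝔻, HasSum (fun n : ℕ => a n * (z : ℂ) ^ n) (f z)}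
  zero_mem' := ⟨0, fun z => by simp⟩
  add_mem' := by
    rintro f g ⟨a, ha⟩ ⟨b, hb⟩
    exact ⟨a + b, fun z => by simpa [add_mul] using (ha z).add (hb z)⟩
  smul_mem' := by
    rintro c f ⟨a, ha⟩
    exact ⟨c • a, fun z => by simpa [mul_assoc] using (ha z).mul_left c⟩

/-- The Hardy space `H²(𝔻)`, as a space of functions on the disc. -/
def H2 : Type := hardySubmodule

namespace H2

instance : AddCommGroup H2 := inferInstanceAs (AddCommGroup hardySubmodule)
instance : Module ℂ H2 := inferInstanceAs (Module ℂ hardySubmodule)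

instance : CoeFun H2 (fun _ => 𝔻 → ℂ) := ⟨fun f => f.1⟩

theorem ext {f g : H2} (h : ∀ z : 𝔻, f z = g z) : f = g := Subtype.ext (funext h)

@[simp] theorem add_apply (f g : H2) (z : 𝔻) : (f + g) z = f z + g z := rfl
@[simp] theorem smul_apply (c : ℂ) (f : H2) (z : 𝔻) : (c • f) z = c * f z := rfl
@[simp] theorem zero_apply (z : 𝔻) : (0 : H2) z = 0 := rfl

theorem summable_pow (a : Seq) (z : 𝔻) : Summable (fun n : ℕ => a n * (z : ℂ) ^ n) := by
  have hz := z.norm_lt_one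
  refine Summable.of_norm_bounded
    ((summable_geometric_of_lt_one (norm_nonneg _) hz).mul_left ‖a‖) fun n => ?_
  rw [norm_mul, norm_pow]
  gcongr
  exact lp.norm_apply_le_norm (by norm_num) a n

/-- The function with a given square-summable coefficient sequence. -/
def ofCoeff : Seq →ₗ[ℂ] H2 where
  toFun a := ⟨fun z => ∑' n : ℕ, a n * (z : ℂ) ^ n, a, fun z => (summable_pow a z).hasSum⟩
  map_add' a b := by
    apply ext
    intro z
    change ∑' n : ℕ, (a + b) n * (z : ℂ) ^ n = _ + _
    rw [← (summable_pow a z).tsum_add (summable_pow b z)]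
    simp [add_mul]
  map_smul' c a := by
    apply ext
    intro z
    change ∑' n : ℕ, (c • a) n * (z : ℂ) ^ n = c * ∑' n : ℕ, a n * (z : ℂ) ^ n
    rw [← tsum_mul_left]
    simp [mul_assoc]

theorem hasSum_ofCoeff (a : Seq) (z : 𝔻) :
    HasSum (fun n : ℕ => a n * (z : ℂ) ^ n) (ofCoeff a z) :=
  (summable_pow a z).hasSum

theorem ofCoeff_injective : Function.Injective ofCoeff := by
  rw [← LinearMap.ker_eq_bot, LinearMap.ker_eq_bot']
  intro a ha
  have hs : HasFPowerSeriesOnBall (fun _ : ℂ => (0 : ℂ))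
      (FormalMultilinearSeries.ofScalars ℂ (fun n => a n)) 0 1 := by
    refine ⟨?_, one_pos, fun {y} hy => ?_⟩
    · refine ENNReal.le_of_forall_nnreal_lt fun r hr => ?_
      refine FormalMultilinearSeries.le_radius_of_bound _ ‖a‖ fun n => ?_
      rw [FormalMultilinearSeries.ofScalars_norm]
      have h1 : (r : ℝ) ≤ 1 := by exact_mod_cast hr.le
      calc ‖a n‖ * (r : ℝ) ^ n ≤ ‖a‖ * 1 := by
            gcongr
            · exact lp.norm_apply_le_norm (by norm_num) a n
            · exact pow_le_one₀ r.2 h1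
        _ = ‖a‖ := mul_one _
    · have hy' : ‖y‖ < 1 := by
        rw [Metric.mem_eball, edist_zero_right, ← ofReal_norm] at hy
        simpa only [ENNReal.ofReal_lt_one] using hy
      have := hasSum_ofCoeff a (Complex.UnitDisc.mk y hy')
      rw [ha] at this
      simpa [mul_comm] using this
  have h0 := hs.hasFPowerSeriesAt.eq_zero
  rw [FormalMultilinearSeries.ofScalars_series_eq_zero] at h0
  apply lp.ext
  funext n
  exact congrFun h0 n

theorem ofCoeff_surjective : Function.Surjective ofCoeff := by
  rintro ⟨f, a, ha⟩
  exact ⟨a, ext fun z => (hasSum_ofCoeff a z).unique (ha z)⟩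

/-- The sequence of Taylor coefficients at the origin of a function in `H²(𝔻)`. -/
def coeff : H2 ≃ₗ[ℂ] Seq :=
  (LinearEquiv.ofBijective ofCoeff ⟨ofCoeff_injective, ofCoeff_surjective⟩).symm

theorem hasSum_coeff (f : H2) (z : 𝔻) : HasSum (fun n : ℕ => coeff f n * (z : ℂ) ^ n) (f z) := by
  obtain ⟨a, rfl⟩ := ofCoeff_surjective f
  have : coeff (ofCoeff a) = a :=
    (LinearEquiv.ofBijective ofCoeff ⟨ofCoeff_injective, ofCoeff_surjective⟩).symm_apply_apply a
  rw [this]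
  exact hasSum_ofCoeff a z

/-- Any square-summable power series representing `f` is its sequence of coefficients. -/
theorem coeff_eq (f : H2) (a : Seq)
    (ha : ∀ z : 𝔻, HasSum (fun n : ℕ => a n * (z : ℂ) ^ n) (f z)) : coeff f = a :=
  ofCoeff_injective (ext fun z =>
    ((hasSum_ofCoeff _ z).unique (hasSum_coeff f z)).trans ((ha z).unique (hasSum_ofCoeff a z)))

/-- The norm of `H²(𝔻)` is the `ℓ²` norm of the coefficients: `‖f‖² = ∑ |aₙ|²`. -/
instance : NormedAddCommGroup H2 :=
  NormedAddCommGroup.induced H2 Seq coeff coeff.injective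

theorem norm_coeff (f : H2) : ‖coeff f‖ = ‖f‖ := rfl

/-- The inner product of `H²(𝔻)` is the `ℓ²` inner product of the coefficients. -/
instance : InnerProductSpace ℂ H2 where
  norm_smul_le c f := by simp [← norm_coeff, norm_smul]
  inner f g := inner ℂ (coeff f) (coeff g)
  norm_sq_eq_re_inner f := norm_sq_eq_re_inner (𝕜 := ℂ) (coeff f)
  conj_inner_symm f g := inner_conj_symm (coeff f) (coeff g)
  add_left f g h := by rw [map_add, inner_add_left]
  smul_left f g c := by rw [map_smul, inner_smul_left]

/-- The isometric isomorphism of `H²(𝔻)` with `ℓ²`. -/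
def coeffIsometry : H2 ≃ₗᵢ[ℂ] Seq := { coeff with norm_map' := norm_coeff }

instance : CompleteSpace H2 :=
  (completeSpace_congr (e := coeffIsometry.toEquiv) coeffIsometry.isometry.isUniformEmbedding).2
    inferInstance

theorem norm_sq_eq (f : H2) : ‖f‖ ^ 2 = ∑' n : ℕ, ‖coeff f n‖ ^ 2 := by
  have h := lp.norm_rpow_eq_tsum (p := 2) (by norm_num) (coeff f)
  rw [norm_coeff] at h
  exact_mod_cast h

end H2

/-- The coefficient sequence `(0, a₀, a₁, …)`. -/
def shiftFun (a : ℕ → ℂ) : ℕ → ℂ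
  | 0 => 0
  | n + 1 => a n

theorem hasSum_shiftFun (a : Seq) :
    HasSum (fun n => ‖shiftFun a n‖ ^ (2 : ENNReal).toReal) (‖a‖ ^ (2 : ENNReal).toReal) := by
  rw [← hasSum_nat_add_iff' 1]
  simpa [shiftFun] using lp.hasSum_norm (p := 2) (by norm_num) a

theorem exists_shift (f : H2) :
    ∃ F : H2, (∀ z : 𝔻, F z = (z : ℂ) * f z) ∧ ‖F‖ = ‖f‖ := by
  have hs := hasSum_shiftFun (H2.coeff f)
  let b : Seq := ⟨shiftFun (H2.coeff f), memℓp_gen hs.summable⟩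
  have hb : ∀ z : 𝔻, HasSum (fun n : ℕ => b n * (z : ℂ) ^ n) ((z : ℂ) * f z) := by
    intro z
    rw [← hasSum_nat_add_iff' 1]
    have := (H2.hasSum_coeff f z).mul_left (z : ℂ)
    have h0 : b 0 = 0 := rfl
    have h1 : ∀ n, b (n + 1) = H2.coeff f n := fun n => rfl
    simp only [Finset.range_one, Finset.sum_singleton, h0, h1, zero_mul, sub_zero]
    exact this.congr_fun fun n => by ring
  let F : H2 := ⟨fun z => (z : ℂ) * f z, b, hb⟩
  refine ⟨F, fun z => rfl, ?_⟩
  rw [← H2.norm_coeff, H2.coeff_eq F b hb, ← H2.norm_coeff]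
  have h := lp.hasSum_norm (p := 2) (by norm_num) b
  have h2 := h.unique hs
  simpa using h2

/-- The forward shift `(S f)(z) = z f(z)`, an isometry of `H²(𝔻)`. -/
def shift : H2 →ₗᵢ[ℂ] H2 where
  toFun f := ⟨fun z => (z : ℂ) * f z, by
    obtain ⟨F, hF, -⟩ := exists_shift f
    rw [← funext hF]
    exact F.2⟩
  map_add' f g := H2.ext fun z => mul_add _ _ _
  map_smul' c f := H2.ext fun z => mul_left_comm _ _ _
  norm_map' f := by
    obtain ⟨F, hF, hn⟩ := exists_shift f
    rw [← hn]
    exact congrArg norm (H2.ext fun z => (hF z).symm)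

/-- The backward shift `S*`, the Hilbert space adjoint of the shift. -/
def backwardShift : H2 →L[ℂ] H2 := ContinuousLinearMap.adjoint shift.toContinuousLinearMap

/-- `M` is nearly `S*`-invariant: `f ∈ M` whenever `S f ∈ M`. -/
def NearlyInvariant (M : Submodule ℂ H2) : Prop := ∀ f : H2, shift f ∈ M → f ∈ M

/-- `K` is `S*`-invariant: `S* f ∈ K` whenever `f ∈ K`. -/
def BackwardInvariant (K : Submodule ℂ H2) : Prop := ∀ f ∈ K, backwardShift f ∈ K

/-- `g ∈ H^∞(𝔻)`: `g` is a bounded analytic function on the open unit disc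
(its values outside the disc are irrelevant). -/
structure IsHInfty (g : ℂ → ℂ) : Prop where
  differentiableOn : DifferentiableOn ℂ g (Metric.ball 0 1)
  bounded : ∃ C : ℝ, ∀ z ∈ Metric.ball (0 : ℂ) 1, ‖g z‖ ≤ C

/-- `u` is an inner function: a bounded analytic function on the disc whose radial limits exist and
have modulus one at almost every point `e^{it}` of the unit circle. -/
structure IsInner (u : ℂ → ℂ) : Prop extends IsHInfty u where
  radial : ∀ᵐ t : ℝ, ∃ w : ℂ, ‖w‖ = 1 ∧
    Tendsto (fun r : ℝ => u (r * Complex.exp (t * Complex.I))) (𝓝[<] 1) (𝓝 w)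

/-- The subspace of all functions in `H²(𝔻)` of the form `φ k` with `k ∈ K`. -/
def mulSubmodule (φ : 𝔻 → ℂ) (K : Submodule ℂ H2) : Submodule ℂ H2 where
  carrier := {F | ∃ k ∈ K, ∀ z : 𝔻, F z = φ z * k z}
  zero_mem' := ⟨0, K.zero_mem, fun z => by simp⟩
  add_mem' := by
    rintro F G ⟨k, hk, hF⟩ ⟨l, hl, hG⟩
    exact ⟨k + l, K.add_mem hk hl, fun z => by simp [hF, hG, mul_add]⟩
  smul_mem' := by
    rintro c F ⟨k, hk, hF⟩
    exact ⟨c • k, K.smul_mem c hk, fun z => by simp [hF, mul_left_comm]⟩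

/-- The model space `K_u = H²(𝔻) ⊖ u H²(𝔻)`. -/
def modelSpace (u : ℂ → ℂ) : Submodule ℂ H2 := (mulSubmodule (fun z => u z) ⊤)ᗮ

/-- Multiplication by `h` is an isometry from `K` into `H²(𝔻)`. -/
def IsIsometricMultiplier (h : 𝔻 → ℂ) (K : Submodule ℂ H2) : Prop :=
  ∀ k ∈ K, ∃ F : H2, (∀ z : 𝔻, F z = h z * k z) ∧ ‖F‖ = ‖k‖

end Hardy

end

/-! Near invariance. Since `θ` is not constant, some `e ∈ K_θ` has `e(0) ≠ 0`; put `E = ge`. The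
continuous map `Φ(F) = S*(F - (F(0)/E(0)) E)` sends `gK_θ` into itself, because the difference is
`g` times an element of `K_θ` vanishing at `0`, from which a factor `z` can be divided out inside
`K_θ`. So `Φ` preserves the closure, and `Φ(Sf) = f`.

The representation is Hitt's theorem followed by Beurling's. Let `M` be closed and nearly invariant,
and `h` its normalized reproducing kernel at `0`. For `f ∈ M` the function `f - ⟨h, f⟩ h` vanishes
at `0`, hence equals `S(Rf)` with `Rf = S*(f - ⟨h, f⟩ h) ∈ M`, and `‖f‖² = |⟨h, f⟩|² + ‖Rf‖²`.
Iteration gives `f = hq` with `q = ∑ ⟨h, Rⁿf⟩ zⁿ`, and `‖q‖ = ‖f‖` precisely when `Rⁿf → 0`. Since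
`f ↦ q` turns `R` into `S*`, the set of all `q` is a closed `S*`-invariant subspace, which
Beurling's theorem identifies.

The analytic core is thus the strong stability of `R` (`tendsto_pow_quotientShift`). On Szegő
kernels, `R k_w = w̄ k_w + c R1` with `c` the conjugate of `h(w)/h(0)`. With `l = lim ‖Rⁿ1‖` and `a`
representing `y ↦ lim ⟨Rⁿ1, Rⁿy⟩`, comparing asymptotic norms gives `|c|² l² ≤ 2 Re(c a(w))`.
Integrated over the circle, the right side becomes a multiple of `⟨h, a⟩`, which is `0` because `Rh
= 0`; so `l = 0`. Then `Rⁿk_w → 0` for every `w`, and kernels span a dense subspace.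

Boundary values come from Fatou's theorem for `H²`: the primitive of the boundary function is
differentiable almost everywhere, and its differentiated Fourier series is Abel summable to the
derivative. -/

noncomputable section

namespace Hardy

/-! ### Abel summability of differentiated Fourier series. -/

section AbelDerivative

open MeasureTheory Real

/-- The conjugate-type kernel `-∂ₛ Pᵣ(s)`, where `Pᵣ` is the Poisson kernel. -/
def derivPoisson (r s : ℝ) : ℝ :=
  2 * r * (1 - r ^ 2) * sin s / (1 - 2 * r * cos s + r ^ 2) ^ 2

theorem one_sub_two_mul_cos_add_sq_pos {r : ℝ} (hr : r ∈ Set.Ico (0 : ℝ) 1) (s : ℝ) :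
    0 < 1 - 2 * r * cos s + r ^ 2 := by
  nlinarith [cos_le_one s, hr.1, hr.2, mul_nonneg hr.1 (sub_nonneg.2 (cos_le_one s)),
    mul_pos (sub_pos.2 hr.2) (sub_pos.2 hr.2)]

theorem continuous_derivPoisson {r : ℝ} (hr : r ∈ Set.Ico (0 : ℝ) 1) :
    Continuous (derivPoisson r) := by
  unfold derivPoisson
  refine Continuous.div (by fun_prop) (by fun_prop) fun s => ?_
  exact (pow_pos (one_sub_two_mul_cos_add_sq_pos hr s) 2).ne'

theorem hasSum_derivPoisson {r : ℝ} (hr : r ∈ Set.Ico (0 : ℝ) 1) (s : ℝ) :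
    HasSum (fun n : ℕ => n * r ^ n *
      (Complex.exp (n * s * Complex.I) - Complex.exp (-(n * s * Complex.I))) / Complex.I)
      (derivPoisson r s : ℂ) := by
  have key : ∀ s : ℝ, HasSum (fun n : ℕ => (n : ℂ) * (r * Complex.exp (s * Complex.I)) ^ n)
      (r * Complex.exp (s * Complex.I) / (1 - r * Complex.exp (s * Complex.I)) ^ 2) := by
    intro s
    apply hasSum_coe_mul_geometric_of_norm_lt_one
    rw [norm_mul, Complex.norm_exp_ofReal_mul_I, Complex.norm_real, Real.norm_of_nonneg hr.1]
    simpa using hr.2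
  have h1 := ((key s).sub (key (-s))).div_const Complex.I
  have e1 : ∀ n : ℕ, Complex.exp (n * s * Complex.I) = Complex.exp (s * Complex.I) ^ n := by
    intro n; rw [← Complex.exp_nat_mul]; ring_nf
  have e2 : ∀ n : ℕ, Complex.exp (-(n * s * Complex.I)) =
      Complex.exp ((-s : ℝ) * Complex.I) ^ n := by
    intro n; rw [← Complex.exp_nat_mul]; push_cast; ring_nf
  suffices hval : (derivPoisson r s : ℂ) =
      (r * Complex.exp (s * Complex.I) / (1 - r * Complex.exp (s * Complex.I)) ^ 2 -
        r * Complex.exp ((-s : ℝ) * Complex.I) /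
          (1 - r * Complex.exp ((-s : ℝ) * Complex.I)) ^ 2) / Complex.I by
    rw [hval]
    refine h1.congr_fun fun n => ?_
    rw [e1, e2]
    ring
  · have hI := Complex.I_ne_zero
    have a1 : Complex.exp (s * Complex.I) = cos s + sin s * Complex.I := by
      rw [Complex.exp_mul_I]; simp
    have a2 : Complex.exp ((-s : ℝ) * Complex.I) = cos s - sin s * Complex.I := by
      rw [Complex.exp_mul_I]; simp [sub_eq_add_neg]
    have ne : ∀ s : ℝ, 1 - r * Complex.exp (s * Complex.I) ≠ 0 := by
      intro s h
      have : ‖(r : ℂ) * Complex.exp (s * Complex.I)‖ = 1 := by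
        rw [← sub_eq_zero.1 h]; simp
      rw [norm_mul, Complex.norm_exp_ofReal_mul_I, Complex.norm_real, Real.norm_of_nonneg hr.1]
        at this
      linarith [hr.2]
    have hd : (1 - 2 * r * cos s + r ^ 2 : ℂ) = (1 - r * Complex.exp (s * Complex.I)) *
        (1 - r * Complex.exp ((-s : ℝ) * Complex.I)) := by
      rw [a1, a2]
      have : (cos s : ℂ) ^ 2 + (sin s : ℂ) ^ 2 = 1 := by exact_mod_cast Real.cos_sq_add_sin_sq s
      linear_combination (-(r:ℂ) ^ 2) * this + (r : ℂ) ^ 2 * (sin s : ℂ) ^ 2 * Complex.I_sq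
    have hq : (derivPoisson r s : ℂ) =
        2 * r * (1 - r ^ 2) * sin s / (1 - 2 * r * cos s + r ^ 2) ^ 2 := by
      unfold derivPoisson; push_cast; rfl
    rw [hq, hd, div_sub_div _ _ (pow_ne_zero 2 (ne s)) (pow_ne_zero 2 (ne (-s))), mul_pow, div_div,
      div_eq_div_iff (mul_ne_zero (pow_ne_zero 2 (ne s)) (pow_ne_zero 2 (ne (-s))))
        (mul_ne_zero (mul_ne_zero (pow_ne_zero 2 (ne s)) (pow_ne_zero 2 (ne (-s)))) hI)]
    have hs : (cos s : ℂ) ^ 2 + (sin s : ℂ) ^ 2 = 1 := by exact_mod_cast Real.cos_sq_add_sin_sq s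
    have num : (r : ℂ) * Complex.exp (s * Complex.I) *
        (1 - r * Complex.exp ((-s : ℝ) * Complex.I)) ^ 2 -
        (1 - r * Complex.exp (s * Complex.I)) ^ 2 * (r * Complex.exp ((-s : ℝ) * Complex.I)) =
        2 * r * (1 - r ^ 2) * sin s * Complex.I := by
      rw [a1, a2]
      have hI2 := Complex.I_sq
      linear_combination (-2 * (r:ℂ) ^ 3 * sin s * Complex.I) * hs +
        (2 * (r:ℂ) ^ 3 * sin s * Complex.I * (sin s : ℂ) ^ 2) * hI2
    rw [num]
    ring

theorem integral_exp_int_mul_I (k : ℤ) :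
    ∫ s in (-π)..π, Complex.exp (k * s * Complex.I) = if k = 0 then 2 * (π : ℂ) else 0 := by
  split_ifs with h
  · subst h; simp; ring
  · have hk : (k : ℂ) * Complex.I ≠ 0 := mul_ne_zero (by exact_mod_cast h) Complex.I_ne_zero
    have : ∀ s : ℝ, Complex.exp (k * s * Complex.I) = Complex.exp ((k * Complex.I) * s) := by
      intro s; ring_nf
    simp_rw [this]
    rw [integral_exp_mul_complex hk, div_eq_zero_iff]
    left
    rw [sub_eq_zero, Complex.exp_eq_exp_iff_exists_int]
    exact ⟨k, by push_cast; ring⟩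

/-- Orthogonality of exponentials in the expansion of the kernel leaves only the term `n = m`:
integrating against the kernel differentiates and Abel-damps a series at `0`. -/
theorem integral_exp_mul_derivPoisson {r : ℝ} (hr : r ∈ Set.Ico (0 : ℝ) 1) (m : ℕ) :
    ∫ s in (-π)..π, Complex.exp (m * s * Complex.I) * derivPoisson r s =
      2 * π * (Complex.I * m * (r : ℂ) ^ m) := by
  have hsum : HasSum (fun n : ℕ => ∫ s in (-π)..π, Complex.exp (m * s * Complex.I) *
      (n * (r : ℂ) ^ n *
      (Complex.exp (n * s * Complex.I) - Complex.exp (-(n * s * Complex.I))) / Complex.I))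
      (∫ s in (-π)..π, Complex.exp (m * s * Complex.I) * derivPoisson r s) := by
    refine intervalIntegral.hasSum_integral_of_dominated_convergence
      (fun n _ => 2 * (n * r ^ n)) (fun n => ?_) (fun n => ?_) ?_ ?_ ?_
    · exact (Continuous.aestronglyMeasurable (by fun_prop))
    · refine Eventually.of_forall fun s _ => ?_
      have e : ∀ n : ℕ, ‖Complex.exp (n * s * Complex.I)‖ = 1 := fun n => by
        have := Complex.norm_exp_ofReal_mul_I (n * s); push_cast at this; exact this
      have e' : ∀ n : ℕ, ‖Complex.exp (-(n * s * Complex.I))‖ = 1 := fun n => by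
        rw [Complex.exp_neg, norm_inv, e, inv_one]
      rw [norm_mul, e, one_mul, norm_div, Complex.norm_I, div_one, norm_mul, norm_mul, norm_pow,
        Complex.norm_real, Real.norm_of_nonneg hr.1, mul_comm (2 : ℝ)]
      simp only [RCLike.norm_natCast]
      have := hr.1
      gcongr
      refine (norm_sub_le _ _).trans ?_
      rw [e, e']; norm_num
    · refine Eventually.of_forall fun s _ => ?_
      have := (hasSum_coe_mul_geometric_of_norm_lt_one (r := r)
        (by rw [Real.norm_of_nonneg hr.1]; exact hr.2)).summable
      exact this.mul_left 2
    · exact intervalIntegrable_const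
    · refine Eventually.of_forall fun s _ => ?_
      exact (hasSum_derivPoisson hr s).mul_left _
  refine hsum.unique ?_
  have hterm : ∀ n : ℕ, ∫ s in (-π)..π, Complex.exp (m * s * Complex.I) *
      (n * (r : ℂ) ^ n *
      (Complex.exp (n * s * Complex.I) - Complex.exp (-(n * s * Complex.I))) / Complex.I) =
      if n = m then 2 * π * (Complex.I * m * (r : ℂ) ^ m) else 0 := by
    intro n
    have h1 : ∀ s : ℝ, Complex.exp (m * s * Complex.I) *
      (n * (r : ℂ) ^ n *
      (Complex.exp (n * s * Complex.I) - Complex.exp (-(n * s * Complex.I))) / Complex.I) =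
      (n * (r : ℂ) ^ n / Complex.I) * (Complex.exp (((m + n : ℤ) : ℂ) * s * Complex.I) -
        Complex.exp (((m - n : ℤ) : ℂ) * s * Complex.I)) := by
      intro s
      have : Complex.exp (((m + n : ℤ) : ℂ) * s * Complex.I) =
          Complex.exp (m * s * Complex.I) * Complex.exp (n * s * Complex.I) := by
        rw [← Complex.exp_add]; push_cast; ring_nf
      rw [this]
      have : Complex.exp (((m - n : ℤ) : ℂ) * s * Complex.I) =
          Complex.exp (m * s * Complex.I) * Complex.exp (-(n * s * Complex.I)) := by
        rw [← Complex.exp_add]; push_cast; ring_nf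
      rw [this]
      ring
    simp_rw [h1]
    rw [intervalIntegral.integral_const_mul, intervalIntegral.integral_sub
      (Continuous.intervalIntegrable (by fun_prop) _ _)
      (Continuous.intervalIntegrable (by fun_prop) _ _),
      integral_exp_int_mul_I, integral_exp_int_mul_I]
    rcases eq_or_ne n m with rfl | hnm
    · rcases Nat.eq_zero_or_pos n with rfl | hn
      · simp
      · have : ((n : ℤ) + n) ≠ 0 := by omega
        simp only [this, if_false, sub_self, if_true, zero_sub, Complex.div_I]
        ring
    · have h2 : ((m : ℤ) - n) ≠ 0 := by omega
      simp only [h2, if_false, hnm, sub_zero]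
      split_ifs with h3
      · have : n = 0 := by omega
        simp [this]
      · simp
  simp_rw [hterm]
  exact hasSum_ite_eq m _

theorem sin_mul_derivPoisson_nonneg {r : ℝ} (hr : r ∈ Set.Ico (0 : ℝ) 1) (s : ℝ) :
    0 ≤ sin s * derivPoisson r s := by
  have h : sin s * derivPoisson r s =
      2 * r * (1 - r ^ 2) * (sin s) ^ 2 / (1 - 2 * r * cos s + r ^ 2) ^ 2 := by
    unfold derivPoisson; ring
  rw [h]
  have h1 := hr.1
  have h2 : 0 ≤ 1 - r ^ 2 := by nlinarith [hr.1, hr.2]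
  positivity

theorem abs_derivPoisson_le {r : ℝ} (hr : r ∈ Set.Ico (0 : ℝ) 1) {s c : ℝ} (hc : c ^ 2 < 1)
    (hs : cos s ≤ c) : |derivPoisson r s| ≤ 2 * (1 - r ^ 2) / (1 - c ^ 2) ^ 2 := by
  unfold derivPoisson
  have h1 := hr.1
  have h2 : 0 ≤ 1 - r ^ 2 := by nlinarith [hr.1, hr.2]
  -- Replacing `cos s` by `c` leaves `(r - c)² + (1 - c²)`.
  have h3 : 1 - c ^ 2 ≤ 1 - 2 * r * cos s + r ^ 2 := by
    nlinarith [sq_nonneg (r - c), mul_nonneg hr.1 (sub_nonneg.2 hs)]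
  have h4 : 0 < 1 - c ^ 2 := by linarith
  rw [abs_div, abs_of_nonneg (a := (1 - 2 * r * cos s + r ^ 2) ^ 2) (sq_nonneg _), abs_mul,
    abs_mul, abs_mul, abs_of_nonneg h1, abs_of_nonneg h2, abs_two]
  refine div_le_div₀ (by positivity) ?_ (by positivity) (by gcongr)
  calc 2 * r * (1 - r ^ 2) * |sin s| ≤ 2 * 1 * (1 - r ^ 2) * 1 := by
        gcongr
        · exact hr.2.le
        · exact abs_sin_le_one s
    _ = _ := by ring

theorem integral_tsum_mul_derivPoisson {r : ℝ} (hr : r ∈ Set.Ico (0 : ℝ) 1) {b : ℕ → ℂ}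
    (hb : Summable fun n => ‖b n‖) :
    ∫ s in (-π)..π, (∑' n, b n * Complex.exp (n * s * Complex.I)) * derivPoisson r s =
      2 * π * ∑' n : ℕ, Complex.I * n * b n * (r : ℂ) ^ n := by
  have hQ := continuous_derivPoisson hr
  have e : ∀ (n : ℕ) (s : ℝ), ‖Complex.exp (n * s * Complex.I)‖ = 1 := fun n s => by
    have := Complex.norm_exp_ofReal_mul_I (n * s); push_cast at this; exact this
  have hsum : HasSum (fun n : ℕ => ∫ s in (-π)..π,
      b n * Complex.exp (n * s * Complex.I) * derivPoisson r s)
      (∫ s in (-π)..π, (∑' n, b n * Complex.exp (n * s * Complex.I)) * derivPoisson r s) := by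
    refine intervalIntegral.hasSum_integral_of_dominated_convergence
      (fun n s => ‖b n‖ * ‖derivPoisson r s‖) (fun n => ?_) (fun n => ?_) ?_ ?_ ?_
    · exact (Continuous.aestronglyMeasurable (by fun_prop))
    · refine Eventually.of_forall fun s _ => ?_
      rw [norm_mul, norm_mul, e, mul_one, Complex.norm_real]
    · exact Eventually.of_forall fun s _ => hb.mul_right _
    · simp_rw [tsum_mul_right]
      exact Continuous.intervalIntegrable (by fun_prop) _ _
    · refine Eventually.of_forall fun s _ => ?_
      refine HasSum.mul_right _ (Summable.hasSum ?_)
      refine Summable.of_norm ?_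
      simpa [norm_mul, e] using hb
  rw [← hsum.tsum_eq, ← tsum_mul_left]
  congr 1
  funext n
  simp_rw [mul_assoc (b n)]
  rw [intervalIntegral.integral_const_mul, integral_exp_mul_derivPoisson hr]
  ring

theorem continuous_tsum_exp {b : ℕ → ℂ} (hb : Summable fun n => ‖b n‖) :
    Continuous fun s : ℝ => ∑' n, b n * Complex.exp (n * s * Complex.I) := by
  refine continuous_tsum (fun n => by fun_prop) hb fun n s => ?_
  have := Complex.norm_exp_ofReal_mul_I (n * s)
  push_cast at this
  rw [norm_mul, this, mul_one]

theorem integral_sin_mul_derivPoisson {r : ℝ} (hr : r ∈ Set.Ico (0 : ℝ) 1) :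
    ∫ s in (-π)..π, sin s * derivPoisson r s = 2 * π * r := by
  have hQ := continuous_derivPoisson hr
  have h := integral_exp_mul_derivPoisson hr 1
  have h' := congrArg Complex.im h
  rw [← Complex.imCLM_apply, ← ContinuousLinearMap.intervalIntegral_comp_comm _
    (Continuous.intervalIntegrable (by fun_prop) _ _)] at h'
  have e1 : ∀ s : ℝ, Complex.imCLM (Complex.exp ((1 : ℕ) * s * Complex.I) * derivPoisson r s)
      = sin s * derivPoisson r s := by
    intro s
    simp [Complex.exp_ofReal_mul_I_im]
  simp_rw [e1] at h'
  rw [h']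
  have e2 : (2 * π * (Complex.I * (1 : ℕ) * (r : ℂ) ^ 1)) = ((2 * π * r : ℝ) : ℂ) * Complex.I := by
    push_cast; ring
  rw [e2]
  simp

/-- An approximate-identity argument: `sin s` times the kernel is nonnegative of mass `2πr`, and
away from `s = 0` the kernel tends uniformly to `0` as `r → 1`. -/
theorem tendsto_tsum_of_hasDerivAt_zero {b : ℕ → ℂ} (hb : Summable fun n => ‖b n‖) {D : ℂ}
    (hD : HasDerivAt (fun s : ℝ => ∑' n, b n * Complex.exp (n * s * Complex.I)) D 0) :
    Tendsto (fun r : ℝ => ∑' n : ℕ, Complex.I * n * b n * (r : ℂ) ^ n) (𝓝[<] 1) (𝓝 D) := by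
  set V : ℝ → ℂ := fun s : ℝ => ∑' n, b n * Complex.exp (n * s * Complex.I) with hV
  have hVc : Continuous V := continuous_tsum_exp hb
  -- The linear part is subtracted as `D sin s` rather than `D s`, since the integral of `sin`
  -- against the kernel is known exactly.
  set E : ℝ → ℂ := fun s => V s - V 0 - D * sin s with hE
  have hEc : Continuous E := by fun_prop
  have hint : ∀ r ∈ Set.Ico (0 : ℝ) 1, ∫ s in (-π)..π, E s * derivPoisson r s =
      2 * π * ((∑' n : ℕ, Complex.I * n * b n * (r : ℂ) ^ n) - D * r) := by
    intro r hr
    have hQ := continuous_derivPoisson hr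
    have i0 : ∫ s in (-π)..π, (derivPoisson r s : ℂ) = 0 := by
      have := integral_exp_mul_derivPoisson hr 0
      simpa using this
    have i1 : ∫ s in (-π)..π, ((sin s * derivPoisson r s : ℝ) : ℂ) = 2 * π * r := by
      rw [intervalIntegral.integral_ofReal, integral_sin_mul_derivPoisson hr]
      push_cast
      rfl
    have e3 : ∀ s : ℝ, E s * derivPoisson r s = V s * derivPoisson r s -
        V 0 * derivPoisson r s - D * ((sin s * derivPoisson r s : ℝ) : ℂ) := by
      intro s; simp only [hE]; push_cast; ring
    simp_rw [e3]
    rw [intervalIntegral.integral_sub (Continuous.intervalIntegrable (by fun_prop) _ _)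
      (Continuous.intervalIntegrable (by fun_prop) _ _),
      intervalIntegral.integral_sub (Continuous.intervalIntegrable (by fun_prop) _ _)
      (Continuous.intervalIntegrable (by fun_prop) _ _),
      intervalIntegral.integral_const_mul, intervalIntegral.integral_const_mul, i0, i1,
      integral_tsum_mul_derivPoisson hr hb]
    ring
  have hEo : E =o[𝓝 0] fun s => sin s := by
    have h1 : E =o[𝓝 0] fun s => s - 0 := by
      have hs : HasDerivAt (fun s : ℝ => V s - D * sin s) (D - D * ((1 : ℝ) : ℂ)) 0 := by
        have hsd := ((Real.hasDerivAt_sin 0).ofReal_comp).const_mul D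
        rw [Real.cos_zero] at hsd
        exact hD.sub hsd
      have := hs.isLittleO
      refine this.congr_left fun s => ?_
      simp [hE]; ring
    refine h1.trans_isBigO ?_
    have h2 := (Real.hasDerivAt_sin 0).isTheta_sub (by simp)
    simpa [Function.comp_def] using h2.2
  obtain ⟨M, hM⟩ : ∃ M, ∀ s ∈ Set.Icc (-π) π, ‖E s‖ ≤ M :=
    (isCompact_Icc).exists_bound_of_continuousOn hEc.continuousOn
  have hM0 : 0 ≤ M := (norm_nonneg _).trans (hM 0 ⟨by linarith [pi_pos], pi_pos.le⟩)
  have hlim : Tendsto (fun r : ℝ => (∑' n : ℕ, Complex.I * n * b n * (r : ℂ) ^ n) - D * r)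
      (𝓝[<] 1) (𝓝 0) := by
    rw [Metric.tendsto_nhds]
    intro ε hε
    have hb1 := hEo.bound (half_pos hε)
    obtain ⟨δ, hδ, hδE⟩ := Metric.eventually_nhds_iff.1 hb1
    -- The cap `1` keeps `d` inside `(0, π)`, so that `cos d ^ 2 < 1`.
    set d := min (δ / 2) 1 with hd
    have hd0 : 0 < d := lt_min (by linarith) one_pos
    have hd1 : d ≤ 1 := min_le_right _ _
    have hdδ : d < δ := (min_le_left _ _).trans_lt (by linarith)
    have hc : cos d ^ 2 < 1 := by
      have := sin_pos_of_pos_of_lt_pi hd0 (by linarith [pi_gt_three])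
      nlinarith [sin_sq_add_cos_sq d]
    have hpt : ∀ r ∈ Set.Ico (0 : ℝ) 1, ∀ s ∈ Set.Icc (-π) π, ‖E s * derivPoisson r s‖ ≤
        ε / 2 * (sin s * derivPoisson r s) + M * (2 * (1 - r ^ 2) / (1 - cos d ^ 2) ^ 2) := by
      intro r hr s hs
      have h2 : 0 ≤ 1 - r ^ 2 := by nlinarith [hr.1, hr.2]
      rw [norm_mul, Complex.norm_real, Real.norm_eq_abs]
      have hnn := sin_mul_derivPoisson_nonneg hr s
      by_cases hsd : |s| < d
      · have h := hδE (y := s) (by rw [Real.dist_0_eq_abs]; linarith)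
        rw [Real.norm_eq_abs] at h
        calc ‖E s‖ * |derivPoisson r s| ≤ (ε / 2 * |sin s|) * |derivPoisson r s| := by gcongr
          _ = ε / 2 * (sin s * derivPoisson r s) := by
            rw [mul_assoc, ← abs_mul, abs_of_nonneg hnn]
          _ ≤ _ := by
            have : 0 ≤ M * (2 * (1 - r ^ 2) / (1 - cos d ^ 2) ^ 2) := by positivity
            linarith
      · push Not at hsd
        have hcos : cos s ≤ cos d := by
          rw [← cos_abs s]
          exact cos_le_cos_of_nonneg_of_le_pi hd0.le (abs_le.2 hs) hsd
        calc ‖E s‖ * |derivPoisson r s| ≤ M * (2 * (1 - r ^ 2) / (1 - cos d ^ 2) ^ 2) := by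
              gcongr
              · exact hM s hs
              · exact abs_derivPoisson_le hr hc hcos
          _ ≤ _ := by
            have : 0 ≤ ε / 2 * (sin s * derivPoisson r s) := by positivity
            linarith
    have hnorm : ∀ r ∈ Set.Ico (0 : ℝ) 1,
        ‖(∑' n : ℕ, Complex.I * n * b n * (r : ℂ) ^ n) - D * r‖ ≤
          ε / 2 * r + M * (2 * (1 - r ^ 2) / (1 - cos d ^ 2) ^ 2) := by
      intro r hr
      have hQ := continuous_derivPoisson hr
      have h1 := intervalIntegral.norm_integral_le_of_norm_le (a := -π) (b := π)
        (f := fun s => E s * derivPoisson r s)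
        (g := fun s => ε / 2 * (sin s * derivPoisson r s) +
          M * (2 * (1 - r ^ 2) / (1 - cos d ^ 2) ^ 2))
        (μ := volume) (by linarith [pi_pos])
        (Eventually.of_forall fun s hs => hpt r hr s ⟨hs.1.le, hs.2⟩)
        (Continuous.intervalIntegrable (by fun_prop) _ _)
      rw [hint r hr, intervalIntegral.integral_add
        (Continuous.intervalIntegrable (by fun_prop) _ _) (by simp),
        intervalIntegral.integral_const_mul, integral_sin_mul_derivPoisson hr, intervalIntegral.integral_const,
        norm_mul] at h1
      have h3 : ‖(2 * π : ℂ)‖ = 2 * π := by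
        rw [norm_mul, Complex.norm_real, Real.norm_of_nonneg pi_pos.le]; simp
      rw [h3, smul_eq_mul] at h1
      have h4 : (0 : ℝ) < 2 * π := by positivity
      refine le_of_mul_le_mul_left ?_ h4
      linarith
    have hcont : Tendsto (fun r : ℝ => ε / 2 * r + M * (2 * (1 - r ^ 2) / (1 - cos d ^ 2) ^ 2))
        (𝓝[<] 1) (𝓝 (ε / 2 * 1 + M * (2 * (1 - 1 ^ 2) / (1 - cos d ^ 2) ^ 2))) := by
      refine Tendsto.mono_left (Continuous.tendsto ?_ 1) nhdsWithin_le_nhds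
      fun_prop
    have hlt : ε / 2 * 1 + M * (2 * (1 - 1 ^ 2) / (1 - cos d ^ 2) ^ 2) < ε := by
      simp; linarith
    have hIco : ∀ᶠ r in 𝓝[<] (1 : ℝ), r ∈ Set.Ico (0 : ℝ) 1 := Ico_mem_nhdsLT one_pos
    filter_upwards [hcont.eventually_lt_const hlt, hIco] with r hr1 hr2
    rw [dist_zero_right]
    exact (hnorm r hr2).trans_lt hr1
  have hDr : Tendsto (fun r : ℝ => D * r) (𝓝[<] 1) (𝓝 (D * (1 : ℝ))) :=
    Tendsto.mono_left (Continuous.tendsto (by fun_prop) 1) nhdsWithin_le_nhds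
  simpa using hlim.add hDr

/-- If an absolutely convergent series `∑ bₙ e^{ins}` is differentiable at `t`, then its formally
differentiated series is Abel summable at `t` to the derivative. -/
theorem tendsto_tsum_of_hasDerivAt {b : ℕ → ℂ} (hb : Summable fun n => ‖b n‖) {D : ℂ} {t : ℝ}
    (hD : HasDerivAt (fun s : ℝ => ∑' n, b n * Complex.exp (n * s * Complex.I)) D t) :
    Tendsto (fun r : ℝ => ∑' n : ℕ, Complex.I * n * b n * (r * Complex.exp (t * Complex.I)) ^ n)
      (𝓝[<] 1) (𝓝 D) := by
  have e : ∀ n : ℕ, Complex.exp (t * Complex.I) ^ n = Complex.exp (n * t * Complex.I) := by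
    intro n; rw [← Complex.exp_nat_mul]; ring_nf
  have h := tendsto_tsum_of_hasDerivAt_zero (b := fun n => b n * Complex.exp (t * Complex.I) ^ n)
    (D := D) ?_ ?_
  · refine h.congr fun r => tsum_congr fun n => ?_
    rw [mul_pow]; ring
  · simpa [norm_mul, Complex.norm_exp_ofReal_mul_I] using hb
  · have h2 : HasDerivAt (fun s : ℝ => s + t) 1 0 := (hasDerivAt_id (0 : ℝ)).add_const t
    have h3 := HasDerivAt.scomp (0 : ℝ) (by simpa using hD) h2
    rw [one_smul] at h3
    refine h3.congr_of_eventuallyEq (Eventually.of_forall fun s => tsum_congr fun n => ?_)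
    simp only [e]
    rw [mul_assoc, ← Complex.exp_add]
    push_cast
    ring_nf

end AbelDerivative

/-! ### Boundary functions on the circle and Fatou's theorem. -/

section Boundary

open MeasureTheory Real AddCircle

instance factTwoPiPos : Fact (0 < 2 * π) := ⟨two_pi_pos⟩

/-- The unit circle, parametrized by angle. -/
abbrev Circ : Type := AddCircle (2 * π)

/-- The normalized arc length measure. -/
abbrev arcLength : Measure Circ := haarAddCircle

/-- The point `e^{ix}` of the unit circle. -/
def expI (x : Circ) : ℂ := fourier 1 x

theorem expI_coe (t : ℝ) : expI (t : Circ) = Complex.exp (t * Complex.I) := by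
  have hpi : (π : ℂ) ≠ 0 := by exact_mod_cast pi_ne_zero
  rw [expI, fourier_coe_apply]
  congr 1
  push_cast
  field_simp

theorem norm_expI (x : Circ) : ‖expI x‖ = 1 := by
  rw [expI, fourier_one]
  exact Circle.norm_coe _

theorem fourier_natCast_eq (n : ℕ) (x : Circ) : fourier (n : ℤ) x = expI x ^ n := by
  induction x using QuotientAddGroup.induction_on with
  | H t =>
    have hpi : (π : ℂ) ≠ 0 := by exact_mod_cast pi_ne_zero
    erw [expI_coe, fourier_coe_apply, ← Complex.exp_nat_mul]
    congr 1
    push_cast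
    field_simp

theorem ae_arcLength_iff {P : Circ → Prop} :
    (∀ᵐ x ∂arcLength, P x) ↔ ∀ᵐ x : Circ, P x := by
  rw [volume_eq_smul_haarAddCircle, Measure.ae_ennreal_smul_measure_iff]
  simp [pi_pos]

theorem ae_arcLength_of_ae_Ioc {P : Circ → Prop}
    (h : ∀ᵐ (t : ℝ) ∂(volume.restrict (Set.Ioc (0 : ℝ) (0 + 2 * π))), P (t : Circ)) :
    ∀ᵐ x ∂arcLength, P x := by
  rw [ae_arcLength_iff]
  rw [ae_restrict_iff_subtype measurableSet_Ioc] at h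
  have := (measurePreserving_equivIoc (2 * π) (a := 0)).quasiMeasurePreserving.ae h
  filter_upwards [this] with x hx
  rwa [coe_equivIoc] at hx

theorem ae_real_of_ae_arcLength {P : Circ → Prop} (h : ∀ᵐ x ∂arcLength, P x) :
    ∀ᵐ t : ℝ, P (t : Circ) := by
  rw [ae_arcLength_iff] at h
  have h1 := iUnion_Ioc_add_zsmul (p := 2 * π) two_pi_pos 0
  rw [← Measure.restrict_univ (μ := (volume : Measure ℝ)), ← h1, ae_restrict_iUnion_iff]
  intro n
  have := (AddCircle.measurePreserving_mk (2 * π) (0 + n • (2 * π))).quasiMeasurePreserving.ae h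
  convert this using 3
  rw [add_smul, one_smul, add_assoc]

theorem orthonormal_fourier_nat :
    Orthonormal ℂ (fun n : ℕ => (fourierLp 2 (n : ℤ) : Lp ℂ 2 arcLength)) :=
  orthonormal_fourier.comp (fun n : ℕ => (n : ℤ)) Nat.cast_injective

/-- The boundary function of `f ∈ H²`, with Fourier series `∑ aₙ e^{inx}`. -/
def bdry : H2 →ₗᵢ[ℂ] Lp ℂ 2 arcLength :=
  orthonormal_fourier_nat.orthogonalFamily.linearIsometry.comp H2.coeffIsometry.toLinearIsometry

theorem hasSum_bdry (f : H2) :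
    HasSum (fun n : ℕ => H2.coeff f n • (fourierLp 2 (n : ℤ) : Lp ℂ 2 arcLength)) (bdry f) := by
  have := orthonormal_fourier_nat.orthogonalFamily.hasSum_linearIsometry (H2.coeff f)
  simp only [LinearIsometry.toSpanSingleton_apply] at this
  exact this

theorem setIntegral_equivIoc_le {t : ℝ} (ht : t ∈ Set.Icc 0 (2 * π)) (F : Circ → ℂ) :
    ∫ x in {x : Circ | (equivIoc (2 * π) 0 x : ℝ) ≤ t}, F x =
      ∫ s in (0 : ℝ)..t, F (s : Circ) := by
  have hm : MeasurableSet {x : Circ | (equivIoc (2 * π) 0 x : ℝ) ≤ t} :=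
    measurableSet_le (measurable_subtype_coe.comp (measurableEquivIoc (2 * π) 0).measurable)
      measurable_const
  rw [← integral_indicator hm, ← AddCircle.integral_preimage (2 * π) 0,
    intervalIntegral.integral_of_le ht.1]
  have hset : Set.Ioc (0 : ℝ) t = Set.Ioc 0 (0 + 2 * π) ∩ Set.Iic t := by
    ext s
    simp only [Set.mem_Ioc, Set.mem_inter_iff, Set.mem_Iic, zero_add]
    constructor
    · rintro ⟨h1, h2⟩; exact ⟨⟨h1, h2.trans ht.2⟩, h2⟩
    · rintro ⟨⟨h1, -⟩, h2⟩; exact ⟨h1, h2⟩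
  rw [hset, ← setIntegral_indicator measurableSet_Iic]
  refine setIntegral_congr_fun measurableSet_Ioc fun s hs => ?_
  simp only [Set.indicator, Set.mem_ofPred_eq, equivIoc_coe_of_mem hs, Set.mem_Iic]

theorem hasSum_integral_bdry (f : H2) {t : ℝ} (ht : t ∈ Set.Icc 0 (2 * π)) :
    HasSum (fun n : ℕ => H2.coeff f n * ∫ s in (0 : ℝ)..t, Complex.exp (n * s * Complex.I))
      (∫ s in (0 : ℝ)..t, bdry f (s : Circ)) := by
  set B : Set Circ := {x : Circ | (equivIoc (2 * π) 0 x : ℝ) ≤ t}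
  have hm : MeasurableSet B :=
    measurableSet_le (measurable_subtype_coe.comp (measurableEquivIoc (2 * π) 0).measurable)
      measurable_const
  have hμ : arcLength B ≠ ⊤ := measure_ne_top _ _
  -- Integration over an arc is an inner product with an indicator, hence continuous on `L²`, so the
  -- Fourier series may be integrated termwise.
  have hval : ∀ F : Lp ℂ 2 arcLength, (2 * π : ℂ) * inner ℂ (indicatorConstLp 2 hm hμ (1 : ℂ)) F =
      ∫ s in (0 : ℝ)..t, F (s : Circ) := by
    intro F
    rw [L2.inner_indicatorConstLp_one, ← setIntegral_equivIoc_le ht,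
      volume_eq_smul_haarAddCircle, Measure.restrict_smul, integral_smul_measure,
      ENNReal.toReal_ofReal two_pi_pos.le, Complex.real_smul]
    push_cast
    rfl
  have h := ((hasSum_bdry f).mapL (innerSL ℂ (indicatorConstLp 2 hm hμ (1 : ℂ)))).mul_left
    (2 * π : ℂ)
  simp only [innerSL_apply_apply, inner_smul_right] at h
  rw [hval] at h
  refine h.congr_fun fun n => ?_
  rw [mul_left_comm, hval]
  congr 1
  have hfc : ∀ᵐ s : ℝ, (fourierLp 2 (n : ℤ) : Lp ℂ 2 arcLength) (s : Circ) =
      Complex.exp (n * s * Complex.I) := by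
    have h1 : ∀ᵐ x ∂arcLength, (fourierLp 2 (n : ℤ) : Lp ℂ 2 arcLength) x = fourier (n : ℤ) x :=
      coeFn_fourierLp 2 (n : ℤ)
    filter_upwards [ae_real_of_ae_arcLength h1] with s hs
    rw [hs, fourier_natCast_eq, expI_coe, ← Complex.exp_nat_mul]
    ring_nf
  exact (intervalIntegral.integral_congr_ae (by filter_upwards [hfc] with s hs _ using hs)).symm

/-- The function `f ∈ H²`, extended to a function on the plane by its power series. -/
def H2.extend (f : H2) (z : ℂ) : ℂ := ∑' n : ℕ, H2.coeff f n * z ^ n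

theorem H2.extend_coe (f : H2) (z : 𝔻) : f.extend z = f z := (H2.hasSum_coeff f z).tsum_eq

/-- Follows from `xy ≤ x² + y²` with `x = |aₙ|`, `y = 1/n`; the term `n = 0` is `0` by the
convention on division. -/
theorem summable_coeff_div (f : H2) : Summable fun n : ℕ => ‖H2.coeff f n / (Complex.I * n)‖ := by
  have h1 : Summable fun n : ℕ => ‖H2.coeff f n‖ ^ 2 := by
    have := (lp.hasSum_norm (p := 2) (by norm_num) (H2.coeff f)).summable
    simpa using this
  have h2 : Summable fun n : ℕ => ((n : ℝ) ^ 2)⁻¹ := Real.summable_nat_pow_inv.2 (by norm_num)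
  refine Summable.of_nonneg_of_le (fun n => norm_nonneg _) (fun n => ?_) (h1.add h2)
  rw [norm_div, norm_mul, Complex.norm_I, one_mul, RCLike.norm_natCast, div_eq_mul_inv]
  have : ((n : ℝ) ^ 2)⁻¹ = ((n : ℝ)⁻¹) ^ 2 := by rw [inv_pow]
  rw [this]
  nlinarith [sq_nonneg (‖H2.coeff f n‖ - (n : ℝ)⁻¹), sq_nonneg ‖H2.coeff f n‖,
    sq_nonneg ((n : ℝ)⁻¹)]

theorem integral_bdry_eq (f : H2) {t : ℝ} (ht : t ∈ Set.Icc 0 (2 * π)) :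
    ∫ s in (0 : ℝ)..t, bdry f (s : Circ) = H2.coeff f 0 * t +
      ((∑' n : ℕ, H2.coeff f n / (Complex.I * n) * Complex.exp (n * t * Complex.I)) -
        ∑' n : ℕ, H2.coeff f n / (Complex.I * n)) := by
  refine (hasSum_integral_bdry f ht).unique ?_
  have hs := summable_coeff_div f
  have hs1 : Summable fun n : ℕ =>
      H2.coeff f n / (Complex.I * n) * Complex.exp (n * t * Complex.I) := by
    refine Summable.of_norm ?_
    refine hs.congr fun n => ?_
    have := Complex.norm_exp_ofReal_mul_I (n * t)
    push_cast at this
    rw [norm_mul, this, mul_one]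
  -- The quotient `a₀ / (i·0)` is `0`, so the contribution `a₀ t` of the constant term is added
  -- separately.
  have h := (hasSum_ite_eq (0 : ℕ) (H2.coeff f 0 * t)).add (hs1.hasSum.sub hs.of_norm.hasSum)
  refine h.congr_fun fun n => ?_
  rcases Nat.eq_zero_or_pos n with rfl | hn
  · simp
  · have hk : Complex.I * (n : ℂ) ≠ 0 :=
      mul_ne_zero Complex.I_ne_zero (by exact_mod_cast hn.ne')
    have : ∀ s : ℝ, Complex.exp (n * s * Complex.I) = Complex.exp ((Complex.I * n) * s) := by
      intro s; ring_nf
    simp_rw [this]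
    rw [integral_exp_mul_complex hk]
    simp only [hn.ne', if_false, zero_add, Complex.ofReal_zero, mul_zero, Complex.exp_zero]
    ring

theorem intervalIntegrable_bdry (f : H2) :
    IntervalIntegrable (fun s : ℝ => bdry f (s : Circ)) volume 0 (2 * π) := by
  have h1 : Integrable (bdry f) arcLength := (Lp.memLp (bdry f)).integrable (by norm_num)
  have h2 : Integrable (bdry f) (volume : Measure Circ) := by
    rw [volume_eq_smul_haarAddCircle]
    exact h1.smul_measure ENNReal.ofReal_ne_top
  have h3 := (AddCircle.measurePreserving_mk (2 * π) 0).integrable_comp_of_integrable h2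
  rw [intervalIntegrable_iff_integrableOn_Ioc_of_le two_pi_pos.le]
  rw [zero_add] at h3
  exact h3

/-- Fatou's theorem for `H²`: the radial limits exist almost everywhere and are given by the
boundary function. -/
theorem ae_tendsto_radial (f : H2) : ∀ᵐ x ∂arcLength,
    Tendsto (fun r : ℝ => f.extend (r * expI x)) (𝓝[<] 1) (𝓝 (bdry f x)) := by
  refine ae_arcLength_of_ae_Ioc ?_
  rw [ae_restrict_iff' measurableSet_Ioc]
  have hne : ∀ᵐ t : ℝ, t ≠ 2 * π := by simp [ae_iff, measure_singleton]
  filter_upwards [(intervalIntegrable_bdry f).ae_hasDerivAt_integral, hne] with t ht htne htI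
  rw [zero_add] at htI
  have htI' : t ∈ Set.Ioo 0 (2 * π) := ⟨htI.1, lt_of_le_of_ne htI.2 htne⟩
  have hd := ht (by rw [Set.uIcc_of_le two_pi_pos.le]; exact ⟨htI.1.le, htI.2⟩) 0
    (by rw [Set.uIcc_of_le two_pi_pos.le]; exact ⟨le_rfl, two_pi_pos.le⟩)
  set b : ℕ → ℂ := fun n => H2.coeff f n / (Complex.I * n) with hb
  -- By Lebesgue differentiation the primitive has derivative `bdry f t`; removing its linear part
  -- `a₀ s` leaves an absolutely convergent series.
  have hV : HasDerivAt (fun s : ℝ => ∑' n, b n * Complex.exp (n * s * Complex.I))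
      (bdry f (t : Circ) - H2.coeff f 0 * (1 : ℝ)) t := by
    have h1 : HasDerivAt (fun s : ℝ => (∫ y in (0 : ℝ)..s, bdry f (y : Circ)) -
        H2.coeff f 0 * s + ∑' n : ℕ, b n) (bdry f (t : Circ) - H2.coeff f 0 * (1 : ℝ)) t :=
      (hd.sub ((hasDerivAt_id t).ofReal_comp.const_mul _)).add_const _
    refine h1.congr_of_eventuallyEq ?_
    filter_upwards [Ioo_mem_nhds htI'.1 htI'.2] with s hs
    rw [integral_bdry_eq f ⟨hs.1.le, hs.2.le⟩]
    ring
  have hlim := (tendsto_tsum_of_hasDerivAt (summable_coeff_div f) hV).const_add (H2.coeff f 0)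
  rw [Complex.ofReal_one, mul_one, add_sub_cancel] at hlim
  refine hlim.congr' ?_
  filter_upwards [Ico_mem_nhdsLT (zero_lt_one (α := ℝ))] with r hr
  rw [expI_coe]
  have hz : ‖(r : ℂ) * Complex.exp (t * Complex.I)‖ < 1 := by
    rw [norm_mul, Complex.norm_exp_ofReal_mul_I, Complex.norm_real, Real.norm_of_nonneg hr.1]
    simpa using hr.2
  have hs := (H2.summable_pow (H2.coeff f) (Complex.UnitDisc.mk _ hz))
  rw [H2.extend]
  rw [Complex.UnitDisc.coe_mk] at hs
  rw [hs.tsum_eq_zero_add, pow_zero, mul_one]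
  congr 1
  have hshift : Summable fun n : ℕ => Complex.I * n * b n *
      (r * Complex.exp (t * Complex.I)) ^ n := by
    refine Summable.congr (f := fun n : ℕ => if n = 0 then 0 else
      H2.coeff f n * (r * Complex.exp (t * Complex.I)) ^ n) ?_ fun n => ?_
    · rw [← summable_nat_add_iff 1] at hs ⊢
      simpa using hs
    · split_ifs with h0
      · simp [h0]
      · have hk : Complex.I * (n : ℂ) ≠ 0 :=
          mul_ne_zero Complex.I_ne_zero (by exact_mod_cast h0)
        simp only [hb]
        rw [mul_div_cancel₀ _ hk]
  rw [hshift.tsum_eq_zero_add]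
  simp only [Nat.cast_zero, mul_zero, zero_mul, zero_add]
  refine tsum_congr fun n => ?_
  have hk : Complex.I * ((n + 1 : ℕ) : ℂ) ≠ 0 :=
    mul_ne_zero Complex.I_ne_zero (by exact_mod_cast Nat.succ_ne_zero n)
  simp only [hb]
  rw [mul_div_cancel₀ _ hk]

theorem inner_eq_integral_bdry (f g : H2) :
    inner ℂ f g = ∫ x, starRingEnd ℂ (bdry f x) * bdry g x ∂arcLength := by
  rw [← bdry.inner_map_map, L2.inner_def]
  congr 1
  funext x
  rw [RCLike.inner_apply, mul_comm]

theorem integrable_norm_sq_bdry (f : H2) : Integrable (fun x => ‖bdry f x‖ ^ 2) arcLength :=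
  (memLp_two_iff_integrable_sq_norm (Lp.memLp (bdry f)).1).1 (Lp.memLp (bdry f))

theorem norm_sq_eq_integral_bdry (f : H2) : ‖f‖ ^ 2 = ∫ x, ‖bdry f x‖ ^ 2 ∂arcLength := by
  have h := inner_eq_integral_bdry f f
  rw [inner_self_eq_norm_sq_to_K] at h
  have : ∀ x, starRingEnd ℂ (bdry f x) * bdry f x = ((‖bdry f x‖ ^ 2 : ℝ) : ℂ) := by
    intro x; rw [Complex.conj_mul']; push_cast; rfl
  simp_rw [this] at h
  rw [integral_complex_ofReal] at h
  exact Complex.ofReal_injective (by rw [Complex.ofReal_pow]; exact h)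

theorem eq_zero_of_ae_bdry {f : H2} (h : ∀ᵐ x ∂arcLength, bdry f x = 0) : f = 0 := by
  rw [← norm_eq_zero, ← sq_eq_zero_iff, norm_sq_eq_integral_bdry]
  rw [integral_eq_zero_of_ae]
  filter_upwards [h] with x hx
  simp [hx]

end Boundary

/-! ### Coefficients, Szegő kernels and the two shifts. -/

section Basic

theorem H2.summable_norm_sq_coeff (f : H2) : Summable fun n : ℕ => ‖H2.coeff f n‖ ^ 2 := by
  have := (lp.hasSum_norm (p := 2) (by norm_num) (H2.coeff f)).summable
  simpa using this

theorem H2.exists_of_coeff {c : ℕ → ℂ} (hc : Summable fun n => ‖c n‖ ^ 2) :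
    ∃ f : H2, ∀ n, H2.coeff f n = c n := by
  have hm : Memℓp c 2 := memℓp_gen (by simpa using hc)
  refine ⟨H2.coeff.symm ⟨c, hm⟩, fun n => ?_⟩
  rw [LinearEquiv.apply_symm_apply]

theorem H2.coeff_ext {f g : H2} (h : ∀ n, H2.coeff f n = H2.coeff g n) : f = g :=
  H2.coeff.injective (lp.ext (funext h))

theorem H2.coeff_unique {f : H2} {c : ℕ → ℂ} (hc : Summable fun n => ‖c n‖ ^ 2)
    (h : ∀ z : 𝔻, HasSum (fun n : ℕ => c n * (z : ℂ) ^ n) (f z)) (n : ℕ) :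
    H2.coeff f n = c n := by
  have hm : Memℓp c 2 := memℓp_gen (by simpa using hc)
  rw [H2.coeff_eq f ⟨c, hm⟩ h]

theorem H2.hasSum_inner (f g : H2) :
    HasSum (fun n : ℕ => starRingEnd ℂ (H2.coeff f n) * H2.coeff g n) (inner ℂ f g) := by
  have := lp.hasSum_inner (𝕜 := ℂ) (H2.coeff f) (H2.coeff g)
  refine HasSum.congr_fun this fun n => ?_
  rw [RCLike.inner_apply, mul_comm]

theorem H2.apply_zero (f : H2) : f 0 = H2.coeff f 0 := by
  refine (H2.hasSum_coeff f 0).unique ?_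
  have := hasSum_ite_eq (0 : ℕ) (H2.coeff f 0)
  refine this.congr_fun fun n => ?_
  rcases Nat.eq_zero_or_pos n with rfl | hn
  · simp
  · simp [hn.ne']

/-- The reproducing kernel of `H²` at a point of the disc. -/
theorem H2.exists_kernel (w : 𝔻) :
    ∃ k : H2, ∀ n, H2.coeff k n = (starRingEnd ℂ (w : ℂ)) ^ n := by
  refine H2.exists_of_coeff ?_
  have h : ‖(w : ℂ)‖ ^ 2 < 1 := w.sq_norm_lt_one
  refine (summable_geometric_of_lt_one (by positivity) h).congr fun n => ?_
  rw [norm_pow, RCLike.norm_conj]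
  ring

/-- The Szegő kernel `k_w(z) = 1 / (1 - w̄ z)`. -/
def kernel (w : 𝔻) : H2 := (H2.exists_kernel w).choose

theorem coeff_kernel (w : 𝔻) (n : ℕ) :
    H2.coeff (kernel w) n = (starRingEnd ℂ (w : ℂ)) ^ n := (H2.exists_kernel w).choose_spec n

theorem inner_kernel (w : 𝔻) (f : H2) : inner ℂ (kernel w) f = f w := by
  refine (H2.hasSum_inner (kernel w) f).unique ?_
  refine (H2.hasSum_coeff f w).congr_fun fun n => ?_
  rw [coeff_kernel, map_pow, RCLike.conj_conj, mul_comm]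

theorem inner_kernel_right (w : 𝔻) (f : H2) :
    inner ℂ f (kernel w) = starRingEnd ℂ (f w) := by
  rw [← inner_conj_symm, inner_kernel]

theorem kernel_self (w : 𝔻) : kernel w w = (‖kernel w‖ : ℂ) ^ 2 := by
  rw [← inner_kernel, inner_self_eq_norm_sq_to_K]
  rfl

theorem kernel_zero_apply (z : 𝔻) : kernel 0 z = 1 := by
  have h := H2.apply_zero (kernel z)
  rw [coeff_kernel, pow_zero, ← inner_kernel, ← inner_conj_symm, inner_kernel] at h
  simpa using congrArg (starRingEnd ℂ) h

theorem norm_kernel_zero : ‖kernel 0‖ = 1 := by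
  have h := kernel_self 0
  rw [kernel_zero_apply] at h
  have h' : ‖kernel 0‖ ^ 2 = 1 := by exact_mod_cast h.symm
  nlinarith [norm_nonneg (kernel 0)]

theorem kernel_ne_zero (w : 𝔻) : kernel w ≠ 0 := by
  intro h
  have h1 := coeff_kernel w 0
  simp [h] at h1

theorem norm_apply_le (f : H2) (w : 𝔻) : ‖f w‖ ≤ ‖kernel w‖ * ‖f‖ := by
  rw [← inner_kernel]
  exact norm_inner_le_norm _ _

theorem continuous_eval (w : 𝔻) : Continuous fun f : H2 => f w := by
  simp_rw [← inner_kernel]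
  fun_prop

theorem H2.sub_apply (f g : H2) (z : 𝔻) : (f - g) z = f z - g z := rfl

theorem shift_apply (f : H2) (z : 𝔻) : shift f z = z * f z := rfl

theorem shift_apply_zero (f : H2) : shift f 0 = 0 := by simp [shift_apply]

theorem inner_backwardShift_left (f g : H2) :
    inner ℂ (backwardShift f) g = inner ℂ f (shift g) :=
  ContinuousLinearMap.adjoint_inner_left _ _ _

theorem inner_backwardShift_right (f g : H2) :
    inner ℂ f (backwardShift g) = inner ℂ (shift f) g :=
  ContinuousLinearMap.adjoint_inner_right _ _ _

theorem backwardShift_shift (f : H2) : backwardShift (shift f) = f := by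
  refine ext_inner_right ℂ fun g => ?_
  rw [inner_backwardShift_left, shift.inner_map_map]

theorem backwardShift_kernel (w : 𝔻) :
    backwardShift (kernel w) = starRingEnd ℂ (w : ℂ) • kernel w := by
  refine ext_inner_right ℂ fun g => ?_
  rw [inner_backwardShift_left, inner_kernel, inner_smul_left, inner_kernel, RCLike.conj_conj,
    shift_apply]

theorem norm_backwardShift_le (f : H2) : ‖backwardShift f‖ ≤ ‖f‖ := by
  have h : ‖backwardShift‖ ≤ 1 := by
    rw [backwardShift, LinearIsometryEquiv.norm_map]
    exact shift.norm_toContinuousLinearMap_le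
  simpa using backwardShift.le_of_opNorm_le h f

/-- `S S*` is self-adjoint, so it is enough to compute it on kernels, where `S S* k_z = k_z - 1`. -/
theorem shift_backwardShift_apply (f : H2) (z : 𝔻) :
    shift (backwardShift f) z = f z - f 0 := by
  have h : backwardShift (kernel z) = starRingEnd ℂ (z : ℂ) • kernel z := backwardShift_kernel z
  have hk : shift (starRingEnd ℂ (z : ℂ) • kernel z) = kernel z - kernel 0 := by
    have hc : ∀ v : 𝔻, kernel z v = (1 - starRingEnd ℂ (z : ℂ) * v)⁻¹ := by
      intro v
      refine (H2.hasSum_coeff (kernel z) v).unique ?_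
      simp_rw [coeff_kernel, ← mul_pow]
      refine hasSum_geometric_of_norm_lt_one ?_
      rw [norm_mul, RCLike.norm_conj]
      nlinarith [z.norm_lt_one, v.norm_lt_one, norm_nonneg (z : ℂ), norm_nonneg (v : ℂ)]
    refine H2.ext fun v => ?_
    have hne : 1 - starRingEnd ℂ (z : ℂ) * v ≠ 0 := by
      intro h0
      have : ‖starRingEnd ℂ (z : ℂ) * v‖ = 1 := by rw [← sub_eq_zero.1 h0]; simp
      rw [norm_mul, RCLike.norm_conj] at this
      nlinarith [z.norm_lt_one, v.norm_lt_one, norm_nonneg (z : ℂ), norm_nonneg (v : ℂ)]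
    rw [shift_apply, H2.smul_apply, H2.sub_apply, kernel_zero_apply, hc]
    linear_combination (-1 : ℂ) * inv_mul_cancel₀ hne
  calc shift (backwardShift f) z = inner ℂ (shift (backwardShift (kernel z))) f := by
        rw [← inner_backwardShift_right, inner_backwardShift_left, inner_kernel]
    _ = f z - f 0 := by rw [h, hk, inner_sub_left, inner_kernel, inner_kernel]

theorem shift_backwardShift {f : H2} (h : f 0 = 0) : shift (backwardShift f) = f :=
  H2.ext fun z => by rw [shift_backwardShift_apply, h, sub_zero]

theorem coeff_shift_zero (f : H2) : H2.coeff (shift f) 0 = 0 := by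
  rw [← H2.apply_zero, shift_apply_zero]

theorem coeff_shift_succ (f : H2) (n : ℕ) :
    H2.coeff (shift f) (n + 1) = H2.coeff f n := by
  have hs := hasSum_shiftFun (H2.coeff f)
  have h := H2.coeff_unique (f := shift f) (c := shiftFun (H2.coeff f))
    (by simpa using hs.summable) ?_ (n + 1)
  · exact h
  · intro z
    rw [← hasSum_nat_add_iff' 1]
    have := (H2.hasSum_coeff f z).mul_left (z : ℂ)
    simp only [Finset.range_one, Finset.sum_singleton, shiftFun, zero_mul, sub_zero]
    exact this.congr_fun fun n => by ring

end Basic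

/-! ### Dilations, integral means and multiplication by `H^∞`. -/

section Extend

open Metric

theorem differentiableOn_extend (f : H2) : DifferentiableOn ℂ f.extend (ball 0 1) := by
  have hs : HasFPowerSeriesOnBall f.extend
      (FormalMultilinearSeries.ofScalars ℂ (fun n => H2.coeff f n)) 0 1 := by
    refine ⟨?_, one_pos, fun {y} hy => ?_⟩
    · refine ENNReal.le_of_forall_nnreal_lt fun r hr => ?_
      refine FormalMultilinearSeries.le_radius_of_bound _ ‖f‖ fun n => ?_
      rw [FormalMultilinearSeries.ofScalars_norm]
      have h1 : (r : ℝ) ≤ 1 := by exact_mod_cast hr.le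
      calc ‖H2.coeff f n‖ * (r : ℝ) ^ n ≤ ‖H2.coeff f‖ * 1 := by
            gcongr
            · exact lp.norm_apply_le_norm (by norm_num) (H2.coeff f) n
            · exact pow_le_one₀ r.2 h1
        _ = ‖f‖ := by rw [mul_one, H2.norm_coeff]
    · have hy' : ‖y‖ < 1 := by
        rw [Metric.mem_eball, edist_zero_right, ← ofReal_norm] at hy
        simpa only [ENNReal.ofReal_lt_one] using hy
      have := (H2.summable_pow (H2.coeff f) (Complex.UnitDisc.mk y hy')).hasSum
      simpa [mul_comm, H2.extend] using this
  have := hs.differentiableOn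
  rwa [← Metric.eball_ofReal, ENNReal.ofReal_one]

theorem norm_mul_expI {r : ℝ} (hr : 0 ≤ r) (x : Circ) : ‖(r : ℂ) * expI x‖ = r := by
  rw [norm_mul, norm_expI, mul_one, Complex.norm_real, Real.norm_of_nonneg hr]

theorem mul_expI_mem_ball {r : ℝ} (hr : r ∈ Set.Ico (0 : ℝ) 1) (x : Circ) :
    (r : ℂ) * expI x ∈ ball (0 : ℂ) 1 := by
  rw [mem_ball_zero_iff, norm_mul_expI hr.1]
  exact hr.2

/-- The point `r e^{ix}` of the disc. -/
def discPoint (r : ℝ) (hr : r ∈ Set.Ico (0 : ℝ) 1) (x : Circ) : 𝔻 :=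
  Complex.UnitDisc.mk (r * expI x) (mem_ball_zero_iff.1 (mul_expI_mem_ball hr x))

theorem ae_bdry_mul {F φ k : H2} (h : ∀ z : 𝔻, F z = φ z * k z) :
    ∀ᵐ x ∂arcLength, bdry F x = bdry φ x * bdry k x := by
  filter_upwards [ae_tendsto_radial F, ae_tendsto_radial φ, ae_tendsto_radial k] with x h1 h2 h3
  refine tendsto_nhds_unique h1 ((h2.mul h3).congr' ?_)
  filter_upwards [Ico_mem_nhdsLT (zero_lt_one (α := ℝ))] with r hr
  have := h (discPoint r hr x)
  rw [← H2.extend_coe, ← H2.extend_coe, ← H2.extend_coe] at this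
  exact this.symm

open MeasureTheory in
-- The dilate `z ↦ G(rz)` lies in `H²`, so Parseval on the unit circle computes the integral means
-- of `G` on the circle of radius `r`.
theorem exists_dilate {G : ℂ → ℂ} (hG : ContinuousOn G (ball 0 1)) {c : ℕ → ℂ}
    (hc : ∀ z : 𝔻, HasSum (fun n => c n * (z : ℂ) ^ n) (G z)) {r : ℝ}
    (hr : r ∈ Set.Ico (0 : ℝ) 1) :
    ∃ H : H2, (∀ n, H2.coeff H n = c n * (r : ℂ) ^ n) ∧
      ∀ᵐ x ∂arcLength, bdry H x = G (r * expI x) := by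
  have hrn : ‖(r : ℂ)‖ < 1 := by
    rw [Complex.norm_real, Real.norm_of_nonneg hr.1]; exact hr.2
  have hs : Summable fun n => ‖c n * (r : ℂ) ^ n‖ := (hc (Complex.UnitDisc.mk r hrn)).summable.norm
  have hm : Memℓp (fun n => c n * (r : ℂ) ^ n) 2 := by
    refine Memℓp.of_exponent_ge (p := 2) (q := 1) (memℓp_gen ?_) (by norm_num)
    simpa using hs
  obtain ⟨H, hH⟩ := H2.exists_of_coeff (c := fun n => c n * (r : ℂ) ^ n)
    (by simpa using (hm.summable (by norm_num)))
  refine ⟨H, hH, ?_⟩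
  filter_upwards [ae_tendsto_radial H] with x hx
  refine tendsto_nhds_unique hx ?_
  have hcont : ContinuousAt G (r * expI x) :=
    hG.continuousAt (isOpen_ball.mem_nhds (mul_expI_mem_ball hr x))
  have h1 : Tendsto (fun ρ : ℝ => (r : ℂ) * (ρ * expI x)) (𝓝[<] 1) (𝓝 (r * expI x)) := by
    have : Tendsto (fun ρ : ℝ => (r : ℂ) * (ρ * expI x)) (𝓝[<] 1)
        (𝓝 (r * ((1 : ℝ) * expI x))) :=
      Tendsto.mono_left (Continuous.tendsto (by fun_prop) 1) nhdsWithin_le_nhds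
    simpa using this
  refine (hcont.tendsto.comp h1).congr' ?_
  filter_upwards [Ico_mem_nhdsLT (zero_lt_one (α := ℝ))] with ρ hρ
  have hz : ‖(r : ℂ) * (ρ * expI x)‖ < 1 := by
    rw [norm_mul, norm_mul_expI hρ.1]
    have := norm_nonneg (r : ℂ)
    nlinarith [hρ.1, hρ.2]
  have h2 := (hc (Complex.UnitDisc.mk _ hz)).tsum_eq
  rw [Complex.UnitDisc.coe_mk] at h2
  rw [Function.comp_apply, ← h2, H2.extend]
  refine tsum_congr fun n => ?_
  rw [hH, mul_pow, mul_assoc]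

open MeasureTheory in
theorem integral_norm_sq_extend_le (k : H2) {r : ℝ} (hr : r ∈ Set.Ico (0 : ℝ) 1) :
    Integrable (fun x => ‖k.extend (r * expI x)‖ ^ 2) arcLength ∧
    ∫ x, ‖k.extend (r * expI x)‖ ^ 2 ∂arcLength ≤ ‖k‖ ^ 2 := by
  obtain ⟨H, hH, hb⟩ := exists_dilate (differentiableOn_extend k).continuousOn
    (fun z => by rw [H2.extend_coe]; exact H2.hasSum_coeff k z) hr
  have hcongr : (fun x => ‖bdry H x‖ ^ 2) =ᵐ[arcLength] fun x => ‖k.extend (r * expI x)‖ ^ 2 := by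
    filter_upwards [hb] with x hx
    rw [hx]
  refine ⟨(integrable_norm_sq_bdry H).congr hcongr, ?_⟩
  rw [← integral_congr_ae hcongr, ← norm_sq_eq_integral_bdry, H2.norm_sq_eq, H2.norm_sq_eq]
  refine H.summable_norm_sq_coeff.tsum_le_tsum (fun n => ?_) k.summable_norm_sq_coeff
  rw [hH, norm_mul, norm_pow, Complex.norm_real, Real.norm_of_nonneg hr.1]
  have h1 : r ^ n ≤ 1 := pow_le_one₀ hr.1 hr.2.le
  have h2 := pow_nonneg hr.1 n
  gcongr
  exact mul_le_of_le_one_right (norm_nonneg _) h1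

open MeasureTheory in
-- Parseval bounds each partial sum of `∑ |cₙ|² r²ⁿ` by `B`; let `r → 1` with the number of terms
-- fixed.
theorem exists_H2_of_integral_le {G : ℂ → ℂ} (hG : DifferentiableOn ℂ G (ball 0 1)) {B : ℝ}
    (hB : ∀ r ∈ Set.Ico (0 : ℝ) 1, ∫ x, ‖G (r * expI x)‖ ^ 2 ∂arcLength ≤ B) :
    ∃ F : H2, ∀ z : 𝔻, F z = G z := by
  set c : ℕ → ℂ := fun n => (n.factorial : ℂ)⁻¹ * iteratedDeriv n G 0
  have hc : ∀ z : 𝔻, HasSum (fun n => c n * (z : ℂ) ^ n) (G z) := by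
    intro z
    have := Complex.hasSum_taylorSeries_on_ball hG (z := z)
      (mem_ball_zero_iff.2 z.norm_lt_one)
    refine this.congr_fun fun n => ?_
    simp only [c, sub_zero, smul_eq_mul]
    ring
  have hpart : ∀ N : ℕ, ∀ r ∈ Set.Ico (0 : ℝ) 1,
      ∑ n ∈ Finset.range N, (‖c n‖ * r ^ n) ^ 2 ≤ B := by
    intro N r hr
    obtain ⟨H, hH, hb⟩ := exists_dilate hG.continuousOn hc hr
    have h1 : ‖H‖ ^ 2 ≤ B := by
      rw [norm_sq_eq_integral_bdry]
      refine le_trans (le_of_eq (integral_congr_ae ?_)) (hB r hr)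
      filter_upwards [hb] with x hx
      rw [hx]
    rw [H2.norm_sq_eq] at h1
    refine le_trans ?_ h1
    refine le_trans (le_of_eq (Finset.sum_congr rfl fun n _ => ?_))
      (H.summable_norm_sq_coeff.sum_le_tsum (Finset.range N) fun n _ => by positivity)
    rw [hH, norm_mul (c n), norm_pow, Complex.norm_real, Real.norm_of_nonneg hr.1]
  have hsum : Summable fun n => ‖c n‖ ^ 2 := by
    refine summable_of_sum_range_le (c := B) (fun n => by positivity) fun N => ?_
    have hlim : Tendsto (fun r : ℝ => ∑ n ∈ Finset.range N, (‖c n‖ * r ^ n) ^ 2) (𝓝[<] 1)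
        (𝓝 (∑ n ∈ Finset.range N, (‖c n‖ * 1 ^ n) ^ 2)) :=
      Tendsto.mono_left (Continuous.tendsto (by fun_prop) 1) nhdsWithin_le_nhds
    simp only [one_pow, mul_one] at hlim
    refine le_of_tendsto hlim ?_
    filter_upwards [Ico_mem_nhdsLT (zero_lt_one (α := ℝ))] with r hr using hpart N r hr
  obtain ⟨F, hF⟩ := H2.exists_of_coeff hsum
  refine ⟨F, fun z => (H2.hasSum_coeff F z).unique ?_⟩
  simp_rw [hF]
  exact hc z

open MeasureTheory in
/-- `H^∞` multiplies `H²` into itself. -/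
theorem IsHInfty.exists_mul {g : ℂ → ℂ} (hg : IsHInfty g) (k : H2) :
    ∃ F : H2, ∀ z : 𝔻, F z = g z * k z := by
  obtain ⟨C, hC⟩ := hg.bounded
  obtain ⟨F, hF⟩ := exists_H2_of_integral_le (G := fun z => g z * k.extend z)
    (B := C ^ 2 * ‖k‖ ^ 2) (hg.differentiableOn.mul (differentiableOn_extend k)) (by
      intro r hr
      obtain ⟨h1, h2⟩ := integral_norm_sq_extend_le k hr
      calc ∫ x, ‖g (r * expI x) * k.extend (r * expI x)‖ ^ 2 ∂arcLength
          ≤ ∫ x, C ^ 2 * ‖k.extend (r * expI x)‖ ^ 2 ∂arcLength := by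
            refine integral_mono_of_nonneg (Eventually.of_forall fun x => by positivity)
              (h1.const_mul _) (Eventually.of_forall fun x => ?_)
            change ‖g (r * expI x) * k.extend (r * expI x)‖ ^ 2 ≤
              C ^ 2 * ‖k.extend (r * expI x)‖ ^ 2
            rw [norm_mul, mul_pow]
            gcongr
            exact hC _ (mul_expI_mem_ball hr x)
        _ = C ^ 2 * ∫ x, ‖k.extend (r * expI x)‖ ^ 2 ∂arcLength := integral_const_mul _ _
        _ ≤ C ^ 2 * ‖k‖ ^ 2 := by gcongr)
  exact ⟨F, fun z => by rw [hF, H2.extend_coe]⟩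

end Extend

/-! ### Inner functions and their unimodular boundary values. -/

section Inner

open MeasureTheory Metric

theorem norm_eq_of_unimodular {u k F : H2} (hu : ∀ᵐ x ∂arcLength, ‖bdry u x‖ = 1)
    (h : ∀ z : 𝔻, F z = u z * k z) : ‖F‖ = ‖k‖ := by
  have h2 : ‖F‖ ^ 2 = ‖k‖ ^ 2 := by
    rw [norm_sq_eq_integral_bdry, norm_sq_eq_integral_bdry]
    refine integral_congr_ae ?_
    filter_upwards [hu, ae_bdry_mul h] with x h1 h2
    rw [h2, norm_mul, h1, one_mul]
  exact (sq_eq_sq₀ (norm_nonneg _) (norm_nonneg _)).1 h2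

/-- Evaluating at `w` gives `|u(w)| ‖k_w‖² = |F(w)| ≤ ‖k_w‖ ‖F‖ = ‖k_w‖²`. -/
theorem norm_apply_le_one {u F : H2} {w : 𝔻} (hF : ∀ z : 𝔻, F z = u z * kernel w z)
    (hn : ‖F‖ = ‖kernel w‖) : ‖u w‖ ≤ 1 := by
  have h1 := norm_apply_le F w
  have hk : 0 < ‖kernel w‖ ^ 2 := pow_pos (norm_pos_iff.2 (kernel_ne_zero w)) 2
  rw [hF, hn, kernel_self, norm_mul, norm_pow, Complex.norm_real, norm_norm, ← sq] at h1
  exact le_of_mul_le_mul_right (by rwa [one_mul]) hk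

/-- An inner function belongs to `H²` and its boundary function is unimodular. -/
theorem IsInner.exists_H2 {θ : ℂ → ℂ} (hθ : IsInner θ) :
    ∃ U : H2, (∀ z : 𝔻, U z = θ z) ∧ ∀ᵐ x ∂arcLength, ‖bdry U x‖ = 1 := by
  obtain ⟨U, hU⟩ := hθ.toIsHInfty.exists_mul (kernel 0)
  have hU' : ∀ z : 𝔻, U z = θ z := fun z => by rw [hU, kernel_zero_apply, mul_one]
  refine ⟨U, hU', ae_arcLength_of_ae_Ioc (ae_restrict_of_ae ?_)⟩
  filter_upwards [hθ.radial, ae_real_of_ae_arcLength (ae_tendsto_radial U)] with t h1 h2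
  obtain ⟨w, hw, hlim⟩ := h1
  have : bdry U (t : Circ) = w := by
    refine tendsto_nhds_unique h2 (hlim.congr' ?_)
    filter_upwards [Ico_mem_nhdsLT (zero_lt_one (α := ℝ))] with r hr
    have h3 := hU' (discPoint r hr t)
    rw [← H2.extend_coe] at h3
    rw [← expI_coe]
    exact h3.symm
  rw [this, hw]

theorem IsInner.norm_le_one {θ : ℂ → ℂ} (hθ : IsInner θ) (w : 𝔻) : ‖θ w‖ ≤ 1 := by
  obtain ⟨U, hU, hb⟩ := hθ.exists_H2
  obtain ⟨F, hF⟩ := hθ.toIsHInfty.exists_mul (kernel w)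
  have hF' : ∀ z : 𝔻, F z = U z * kernel w z := fun z => by rw [hF, hU]
  rw [← hU]
  exact norm_apply_le_one hF' (norm_eq_of_unimodular hb hF')

theorem extend_shift (f : H2) {z : ℂ} (hz : ‖z‖ < 1) : (shift f).extend z = z * f.extend z := by
  have h := shift_apply f (Complex.UnitDisc.mk z hz)
  rwa [← H2.extend_coe, ← H2.extend_coe, Complex.UnitDisc.coe_mk] at h

theorem ae_bdry_shift (f : H2) :
    ∀ᵐ x ∂arcLength, bdry (shift f) x = expI x * bdry f x := by
  filter_upwards [ae_tendsto_radial (shift f), ae_tendsto_radial f] with x h1 h2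
  have h3 : Tendsto (fun r : ℝ => (r : ℂ) * expI x) (𝓝[<] 1) (𝓝 ((1 : ℝ) * expI x)) :=
    Tendsto.mono_left (Continuous.tendsto (by fun_prop) 1) nhdsWithin_le_nhds
  rw [Complex.ofReal_one, one_mul] at h3
  refine tendsto_nhds_unique h1 ((h3.mul h2).congr' ?_)
  filter_upwards [Ico_mem_nhdsLT (zero_lt_one (α := ℝ))] with r hr
  exact (extend_shift f (mem_ball_zero_iff.1 (mul_expI_mem_ball hr x))).symm

theorem ae_bdry_iterate_shift (f : H2) (n : ℕ) :
    ∀ᵐ x ∂arcLength, bdry (shift^[n] f) x = expI x ^ n * bdry f x := by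
  induction n with
  | zero => simp
  | succ n ih =>
    filter_upwards [ih, ae_bdry_shift (shift^[n] f)] with x h1 h2
    rw [Function.iterate_succ_apply', h2, h1, pow_succ']
    ring

theorem ae_eq_zero_of_fourierCoeff {Ψ : Circ → ℂ} (h : MemLp Ψ 2 arcLength)
    (h0 : ∀ n, fourierCoeff Ψ n = 0) : ∀ᵐ x ∂arcLength, Ψ x = 0 := by
  have h1 : h.toLp = 0 := by
    apply fourierBasis.repr.injective
    rw [map_zero]
    apply lp.ext
    funext n
    rw [fourierBasis_repr, fourierCoeff_congr_ae h.coeFn_toLp, h0]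
    rfl
  have h2 := h.coeFn_toLp
  rw [h1] at h2
  filter_upwards [h2, Lp.coeFn_zero ℂ 2 arcLength] with x h3 h4
  rw [← h3, h4]
  rfl

/-- The two families of relations are the vanishing of the Fourier coefficients of `ū f` of
nonnegative and of negative index. Hence `ū f = 0`, and `|u| = 1` on the circle. -/
theorem eq_zero_of_inner_iterate_shift {u f : H2} (hu : ∀ᵐ x ∂arcLength, ‖bdry u x‖ = 1)
    (h1 : ∀ n, inner ℂ (shift^[n] u) f = 0) (h2 : ∀ n, inner ℂ u (shift^[n + 1] f) = 0) :
    f = 0 := by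
  have hm : MemLp (fun x => starRingEnd ℂ (bdry u x) * bdry f x) 2 arcLength := by
    refine (Lp.memLp (bdry f)).of_le ?_ ?_
    · exact (Complex.continuous_conj.comp_aestronglyMeasurable (Lp.memLp (bdry u)).1).mul
        (Lp.memLp (bdry f)).1
    · filter_upwards [hu] with x hx
      rw [norm_mul, RCLike.norm_conj, hx, one_mul]
  have hz := ae_eq_zero_of_fourierCoeff hm ?_
  · refine eq_zero_of_ae_bdry ?_
    filter_upwards [hu, hz] with x h3 h4
    rcases mul_eq_zero.1 h4 with h5 | h5
    · rw [map_eq_zero] at h5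
      simp [h5] at h3
    · exact h5
  · intro n
    obtain ⟨m, rfl | rfl⟩ := n.eq_nat_or_neg
    · rw [fourierCoeff, ← h1 m, inner_eq_integral_bdry]
      refine integral_congr_ae ?_
      filter_upwards [ae_bdry_iterate_shift u m] with x hx
      rw [hx, fourier_neg, fourier_natCast_eq, map_mul, smul_eq_mul]
      ring
    · rcases m with _ | m
      · have := h1 0
        rw [Function.iterate_zero, id_eq, inner_eq_integral_bdry] at this
        rw [fourierCoeff, ← this]
        simp
      · rw [fourierCoeff, ← h2 m, inner_eq_integral_bdry]
        refine integral_congr_ae ?_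
        filter_upwards [ae_bdry_iterate_shift f (m + 1)] with x hx
        rw [hx, neg_neg, fourier_natCast_eq, smul_eq_mul]
        ring

end Inner

/-! ### Beurling's theorem. -/

section Beurling

open MeasureTheory Metric

theorem iterate_shift_apply (f : H2) (n : ℕ) (z : 𝔻) :
    (shift^[n] f) z = (z : ℂ) ^ n * f z := by
  induction n with
  | zero => simp
  | succ n ih => rw [Function.iterate_succ_apply', shift_apply, ih, pow_succ']; ring

theorem inner_iterate_shift_add (f g : H2) (m k : ℕ) :
    inner ℂ (shift^[m] f) (shift^[m + k] g) = inner ℂ f (shift^[k] g) := by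
  induction m with
  | zero => simp
  | succ m ih =>
    rw [show m + 1 + k = (m + k) + 1 by ring, Function.iterate_succ_apply',
      Function.iterate_succ_apply', shift.inner_map_map, ih]

theorem orthonormal_iterate_shift {u : H2} (h1 : ‖u‖ = 1)
    (h : ∀ n, inner ℂ u (shift^[n + 1] u) = 0) : Orthonormal ℂ (fun n => shift^[n] u) := by
  have key : ∀ m k, inner ℂ (shift^[m] u) (shift^[m + (k + 1)] u) = 0 := fun m k => by
    rw [inner_iterate_shift_add, h]
  refine ⟨fun n => ?_, fun m n hmn => ?_⟩
  · induction n with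
    | zero => simpa using h1
    | succ n ih =>
      change ‖shift^[n + 1] u‖ = 1
      rw [Function.iterate_succ_apply', shift.norm_map]
      exact ih
  · rcases lt_or_gt_of_ne hmn with hlt | hlt
    · obtain ⟨k, rfl⟩ := Nat.exists_eq_add_of_lt hlt
      exact key m k
    · obtain ⟨k, rfl⟩ := Nat.exists_eq_add_of_lt hlt
      change inner ℂ (shift^[n + (k + 1)] u) (shift^[n] u) = 0
      rw [← inner_conj_symm, key, map_zero]

/-- A wandering unit vector is an isometric multiplier of `H²`, with values in the shift-invariant
subspace it generates. -/
theorem exists_mul_of_orthonormal {u : H2} (hu : Orthonormal ℂ (fun n => shift^[n] u)) (k : H2) :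
    ∃ F : H2, (∀ z : 𝔻, F z = u z * k z) ∧ ‖F‖ = ‖k‖ ∧
      ∀ x : H2, (∀ n, inner ℂ x (shift^[n] u) = 0) → inner ℂ x F = 0 := by
  have hs := hu.orthogonalFamily.hasSum_linearIsometry (H2.coeff k)
  simp only [LinearIsometry.toSpanSingleton_apply] at hs
  refine ⟨hu.orthogonalFamily.linearIsometry (H2.coeff k), fun z => ?_, ?_, fun x hx => ?_⟩
  · have h := hs.mapL (innerSL ℂ (kernel z))
    simp only [innerSL_apply_apply, inner_kernel, H2.smul_apply, iterate_shift_apply] at h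
    refine h.unique (((H2.hasSum_coeff k z).mul_left (u z)).congr_fun fun n => ?_)
    ring
  · rw [LinearIsometry.norm_map, H2.norm_coeff]
  · have h := hs.mapL (innerSL ℂ x)
    simp only [innerSL_apply_apply, inner_smul_right, hx, mul_zero] at h
    exact h.unique hasSum_zero

/-- The function `1 - |u|²` is nonnegative on the circle and has integral `1 - ‖u‖² = 0`. -/
theorem ae_norm_bdry_eq_one {u : H2} (hn : ‖u‖ = 1) (h : ∀ z : 𝔻, ‖u z‖ ≤ 1) :
    ∀ᵐ x ∂arcLength, ‖bdry u x‖ = 1 := by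
  have hle : ∀ᵐ x ∂arcLength, ‖bdry u x‖ ≤ 1 := by
    filter_upwards [ae_tendsto_radial u] with x hx
    refine le_of_tendsto hx.norm ?_
    filter_upwards [Ico_mem_nhdsLT (zero_lt_one (α := ℝ))] with r hr
    have := h (discPoint r hr x)
    rwa [← H2.extend_coe] at this
  have hint : ∫ x, (1 - ‖bdry u x‖ ^ 2) ∂arcLength = 0 := by
    rw [integral_sub (integrable_const _) (integrable_norm_sq_bdry u),
      ← norm_sq_eq_integral_bdry, hn]
    simp
  rw [integral_eq_zero_iff_of_nonneg_ae] at hint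
  · filter_upwards [hint] with x hx
    have h1 : 1 - ‖bdry u x‖ ^ 2 = 0 := hx
    nlinarith [norm_nonneg (bdry u x)]
  · filter_upwards [hle] with x hx
    have := norm_nonneg (bdry u x)
    change 0 ≤ 1 - ‖bdry u x‖ ^ 2
    nlinarith
  · exact (integrable_const _).sub (integrable_norm_sq_bdry u)

theorem isInner_extend {u : H2} (h : ∀ z : 𝔻, ‖u z‖ ≤ 1)
    (hu : ∀ᵐ x ∂arcLength, ‖bdry u x‖ = 1) : IsInner u.extend where
  differentiableOn := differentiableOn_extend u
  bounded := ⟨1, fun z hz => by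
    have := h (Complex.UnitDisc.mk z (mem_ball_zero_iff.1 hz))
    rwa [← H2.extend_coe, Complex.UnitDisc.coe_mk] at this⟩
  radial := by
    filter_upwards [ae_real_of_ae_arcLength hu, ae_real_of_ae_arcLength (ae_tendsto_radial u)]
      with t h1 h2
    refine ⟨_, h1, ?_⟩
    rw [expI_coe] at h2
    exact h2

theorem exists_inner_eq_coeff (d : ℕ) : ∃ e : H2, ∀ f, inner ℂ e f = H2.coeff f d := by
  obtain ⟨e, he⟩ := H2.exists_of_coeff (c := fun n => if n = d then 1 else 0)
    (summable_of_ne_finset_zero (s := {d}) fun n hn => by simp_all)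
  refine ⟨e, fun f => (H2.hasSum_inner e f).unique ?_⟩
  refine (hasSum_ite_eq d (H2.coeff f d)).congr_fun fun n => ?_
  rw [he]
  split_ifs with h
  · simp [h]
  · simp

/-- A nonzero closed shift-invariant subspace contains a unit vector orthogonal to the image of the
subspace under the shift. -/
theorem exists_wandering {N : Submodule ℂ H2} [N.HasOrthogonalProjection] (hN : N ≠ ⊥)
    (hS : ∀ f ∈ N, shift f ∈ N) :
    ∃ u ∈ N, ‖u‖ = 1 ∧ ∀ f ∈ N, inner ℂ u (shift f) = 0 := by
  classical
  have hex : ∃ d, ∃ f ∈ N, H2.coeff f d ≠ 0 := by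
    obtain ⟨f, hf, hf0⟩ := Submodule.exists_mem_ne_zero_of_ne_bot hN
    by_contra! hcon
    exact hf0 (H2.coeff_ext fun n => by rw [hcon n f hf]; simp)
  obtain ⟨f₀, hf₀, hne⟩ := Nat.find_spec hex
  -- `d` is the least order of vanishing at `0` in `N`. The functional `f ↦ a_d(f)` is nonzero on
  -- `N` but kills `SN`; its representing vector in `N`, normalized, is the required `u`.
  set d := Nat.find hex with hd
  obtain ⟨e, he⟩ := exists_inner_eq_coeff d
  set p : H2 := N.starProjection e with hp
  have hpN : p ∈ N := Submodule.starProjection_apply_mem _ _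
  have hpf : ∀ f ∈ N, inner ℂ p f = H2.coeff f d := fun f hf => by
    rw [← he, hp, Submodule.inner_starProjection_left_eq_right,
      Submodule.starProjection_eq_self_iff.2 hf]
  have hp0 : p ≠ 0 := fun h => hne (by rw [← hpf f₀ hf₀, h, inner_zero_left])
  have hpn : ‖p‖ ≠ 0 := norm_ne_zero_iff.2 hp0
  refine ⟨((‖p‖⁻¹ : ℝ) : ℂ) • p, N.smul_mem _ hpN, ?_, fun f hf => ?_⟩
  · rw [norm_smul, Complex.norm_real, norm_inv, norm_norm, inv_mul_cancel₀ hpn]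
  · rw [inner_smul_left, hpf _ (hS f hf)]
    rcases hdm : d with _ | m
    · rw [coeff_shift_zero, mul_zero]
    · have hmin := Nat.find_min hex (m := m) (by omega)
      push Not at hmin
      rw [coeff_shift_succ, hmin f hf, mul_zero]

theorem modelSpace_extend (u : H2) : modelSpace u.extend = (mulSubmodule u ⊤)ᗮ := by
  have : (fun z : 𝔻 => u.extend z) = u := funext (H2.extend_coe u)
  rw [modelSpace, this]

/-- Beurling's theorem: a closed `S*`-invariant subspace of `H²` is a model space or `H²`. -/
theorem BackwardInvariant.eq_modelSpace {K : Submodule ℂ H2} (hK : BackwardInvariant K)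
    (hc : IsClosed (K : Set H2)) :
    (∃ u : ℂ → ℂ, IsInner u ∧ K = modelSpace u) ∨ K = ⊤ := by
  have : CompleteSpace K := hc.completeSpace_coe
  by_cases hN : Kᗮ = ⊥
  · exact Or.inr (Submodule.orthogonal_eq_bot_iff.1 hN)
  left
  have hshift : ∀ f ∈ Kᗮ, shift f ∈ Kᗮ := fun f hf => by
    rw [Submodule.mem_orthogonal] at hf ⊢
    intro k hk
    rw [← inner_backwardShift_left]
    exact hf _ (hK k hk)
  have hiter : ∀ f ∈ Kᗮ, ∀ n, shift^[n] f ∈ Kᗮ := fun f hf n => by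
    induction n with
    | zero => exact hf
    | succ n ih => rw [Function.iterate_succ_apply']; exact hshift _ ih
  obtain ⟨u, huN, hu1, hw⟩ := exists_wandering hN hshift
  have huS : ∀ f ∈ Kᗮ, ∀ n, inner ℂ u (shift^[n + 1] f) = 0 := fun f hf n => by
    rw [Function.iterate_succ_apply']
    exact hw _ (hiter f hf n)
  have horth := orthonormal_iterate_shift hu1 (huS u huN)
  have hle : ∀ z : 𝔻, ‖u z‖ ≤ 1 := fun w => by
    obtain ⟨F, hF, hn, -⟩ := exists_mul_of_orthonormal horth (kernel w)
    exact norm_apply_le_one hF hn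
  have hub := ae_norm_bdry_eq_one hu1 hle
  have hKU : K ≤ modelSpace u.extend := by
    intro x hx
    rw [modelSpace_extend, Submodule.mem_orthogonal']
    rintro F ⟨k, -, hF⟩
    obtain ⟨F', hF', -, hx'⟩ := exists_mul_of_orthonormal horth k
    have : F = F' := H2.ext fun z => by rw [hF, hF']
    rw [this]
    refine hx' x fun n => ?_
    exact (Submodule.mem_orthogonal _ _).1 (hiter u huN n) x hx
  refine ⟨u.extend, isInner_extend hle hub, le_antisymm hKU ?_⟩
  · intro x hx
    -- The component of `x` orthogonal to `K` lies in both `Kᗮ` and the model space, so it satisfies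
    -- both families of orthogonality relations with `u`.
    set f := x - K.starProjection x with hf
    have hfN : f ∈ Kᗮ := Submodule.sub_starProjection_mem_orthogonal x
    have hfU : f ∈ modelSpace u.extend :=
      Submodule.sub_mem _ hx (hKU (Submodule.starProjection_apply_mem _ _))
    have hf0 : f = 0 := by
      refine eq_zero_of_inner_iterate_shift hub (fun n => ?_) (huS f hfN)
      rw [modelSpace_extend] at hfU
      refine (Submodule.mem_orthogonal _ _).1 hfU _ ⟨shift^[n] (kernel 0), trivial, fun z => ?_⟩
      rw [iterate_shift_apply, iterate_shift_apply, kernel_zero_apply]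
      ring
    have : x = K.starProjection x := sub_eq_zero.1 hf0
    rw [this]
    exact Submodule.starProjection_apply_mem _ _

end Beurling

/-! ### Asymptotic norms and inner products for powers of a contraction. -/

section Contraction

variable {H : Type*} [NormedAddCommGroup H] [InnerProductSpace ℂ H]

theorem antitone_norm_pow {R : H →L[ℂ] H} (hR : ∀ x, ‖R x‖ ≤ ‖x‖) (x : H) :
    Antitone fun n => ‖(R ^ n) x‖ := by
  refine antitone_nat_of_succ_le fun n => ?_
  rw [pow_succ']
  exact hR _

theorem norm_pow_le {R : H →L[ℂ] H} (hR : ∀ x, ‖R x‖ ≤ ‖x‖) (x : H) (n : ℕ) :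
    ‖(R ^ n) x‖ ≤ ‖x‖ := by
  simpa using antitone_norm_pow hR x (Nat.zero_le n)

theorem exists_tendsto_norm_pow {R : H →L[ℂ] H} (hR : ∀ x, ‖R x‖ ≤ ‖x‖) (x : H) :
    ∃ l, Tendsto (fun n => ‖(R ^ n) x‖) atTop (𝓝 l) :=
  ⟨_, tendsto_atTop_ciInf (antitone_norm_pow hR x) ⟨0, by rintro _ ⟨n, rfl⟩; positivity⟩⟩

/-- The norms `‖Rⁿx‖` decrease and so converge; polarization transfers this to inner products. -/
theorem exists_tendsto_inner_pow {R : H →L[ℂ] H} (hR : ∀ x, ‖R x‖ ≤ ‖x‖) (x y : H) :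
    ∃ l, Tendsto (fun n => inner ℂ ((R ^ n) x) ((R ^ n) y)) atTop (𝓝 l) := by
  obtain ⟨l₁, h₁⟩ := exists_tendsto_norm_pow hR (x + y)
  obtain ⟨l₂, h₂⟩ := exists_tendsto_norm_pow hR (x - y)
  obtain ⟨l₃, h₃⟩ := exists_tendsto_norm_pow hR (x - Complex.I • y)
  obtain ⟨l₄, h₄⟩ := exists_tendsto_norm_pow hR (x + Complex.I • y)
  have hc : ∀ {a : ℕ → ℝ} {l : ℝ}, Tendsto a atTop (𝓝 l) →
      Tendsto (fun n => (a n : ℂ) ^ 2) atTop (𝓝 ((l : ℂ) ^ 2)) := fun h =>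
    ((Complex.continuous_ofReal.tendsto _).comp h).pow 2
  refine ⟨_, ((((hc h₁).sub (hc h₂)).add (((hc h₃).sub (hc h₄)).mul_const Complex.I)).div_const
    4).congr fun n => ?_⟩
  rw [inner_eq_sum_norm_sq_div_four]
  simp only [map_add, map_sub, map_smul]
  rfl

/-- The limit of `⟨Rⁿ x, Rⁿ y⟩` as `n → ∞` for a contraction `R` is a bounded functional of `y`. -/
theorem exists_tendsto_inner_pow_eq_inner [CompleteSpace H] {R : H →L[ℂ] H}
    (hR : ∀ x, ‖R x‖ ≤ ‖x‖) (x : H) :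
    ∃ a : H, ∀ y, Tendsto (fun n => inner ℂ ((R ^ n) x) ((R ^ n) y)) atTop (𝓝 (inner ℂ a y)) := by
  choose L hL using exists_tendsto_inner_pow hR x
  let φ : H →ₗ[ℂ] ℂ :=
    { toFun := L
      map_add' := fun y z => by
        refine tendsto_nhds_unique (hL (y + z)) (((hL y).add (hL z)).congr fun n => ?_)
        rw [map_add, inner_add_right]
      map_smul' := fun c y => by
        refine tendsto_nhds_unique (hL (c • y)) (((hL y).const_mul c).congr fun n => ?_)
        rw [map_smul, inner_smul_right] }
  let ψ : H →L[ℂ] ℂ := φ.mkContinuous ‖x‖ fun y => by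
    refine le_of_tendsto (hL y).norm (Eventually.of_forall fun n => ?_)
    exact (norm_inner_le_norm _ _).trans
      (mul_le_mul (norm_pow_le hR x n) (norm_pow_le hR y n) (norm_nonneg _) (norm_nonneg _))
  refine ⟨(InnerProductSpace.toDual ℂ H).symm ψ, fun y => ?_⟩
  rw [InnerProductSpace.toDual_symm_apply]
  exact hL y

end Contraction

/-! ### Strong stability of `f ↦ S*(f - ⟨h, f⟩ h)`. -/

section Stability

open MeasureTheory

/-- The operator `f ↦ S*(f - ⟨h, f⟩ h)`. -/
def quotientShift (h : H2) : H2 →L[ℂ] H2 :=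
  backwardShift.comp
    (ContinuousLinearMap.id ℂ H2 - (innerSL ℂ h).smulRight h)

theorem quotientShift_apply (h f : H2) :
    quotientShift h f = backwardShift (f - inner ℂ h f • h) := rfl

theorem norm_sq_sub_inner_smul {h : H2} (hh : ‖h‖ = 1) (f : H2) :
    ‖f - inner ℂ h f • h‖ ^ 2 = ‖f‖ ^ 2 - ‖(inner ℂ h f : ℂ)‖ ^ 2 := by
  have h1 : inner ℂ (inner ℂ h f • h) (f - inner ℂ h f • h) = (0 : ℂ) := by
    rw [inner_smul_left, inner_sub_right, inner_smul_right, inner_self_eq_norm_sq_to_K, hh]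
    simp
  have h2 := norm_add_sq_eq_norm_sq_add_norm_sq_of_inner_eq_zero _ _ h1
  rw [add_sub_cancel, norm_smul, hh, mul_one] at h2
  rw [sq, sq, sq]
  linarith

theorem norm_quotientShift_le {h : H2} (hh : ‖h‖ = 1) (f : H2) : ‖quotientShift h f‖ ≤ ‖f‖ := by
  refine (norm_backwardShift_le _).trans ?_
  have h1 := norm_sq_sub_inner_smul hh f
  refine (sq_le_sq₀ (norm_nonneg _) (norm_nonneg _)).1 ?_
  change ‖f - inner ℂ h f • h‖ ^ 2 ≤ ‖f‖ ^ 2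
  rw [h1]
  exact sub_le_self _ (sq_nonneg _)

theorem quotientShift_self {h : H2} (hh : ‖h‖ = 1) : quotientShift h h = 0 := by
  rw [quotientShift_apply, inner_self_eq_norm_sq_to_K, hh]
  simp

/-- `k_w` is an eigenvector of `S*`, and the rank-one term contributes a multiple of `S*h`. As `S*1
= 0`, the image of the constant `1 = kernel 0` is also a multiple of `S*h`, nonzero multiple because
`h(0) ≠ 0`. -/
theorem quotientShift_kernel {h : H2} (h0 : h 0 ≠ 0) (w : 𝔻) :
    quotientShift h (kernel w) = starRingEnd ℂ (w : ℂ) • kernel w +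
      starRingEnd ℂ (h w / h 0) • quotientShift h (kernel 0) := by
  have hc : starRingEnd ℂ (h 0) ≠ 0 := (map_ne_zero _).2 h0
  simp only [quotientShift_apply, inner_kernel_right, map_sub, map_smul, backwardShift_kernel,
    Complex.UnitDisc.coe_zero, map_zero, zero_smul, zero_sub, smul_neg, smul_smul, map_div₀]
  rw [div_mul_cancel₀ _ hc, sub_eq_add_neg]

/-- The defect of asymptotic isometry: the basic positivity behind stability. -/
theorem norm_sq_mul_le_of_tendsto {h : H2} (hh : ‖h‖ = 1) (h0 : h 0 ≠ 0) {a : H2} {l : ℝ}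
    (ha : ∀ y, Tendsto (fun n => inner ℂ ((quotientShift h ^ n) (kernel 0))
      ((quotientShift h ^ n) y)) atTop (𝓝 (inner ℂ a y)))
    (hl : Tendsto (fun n => ‖(quotientShift h ^ n) (kernel 0)‖) atTop (𝓝 l)) (w : 𝔻) :
    ‖h w / h 0‖ ^ 2 * l ^ 2 ≤ 2 * (starRingEnd ℂ (h w / h 0) * a w).re := by
  set R := quotientShift h with hR
  have hRle : ∀ f, ‖R f‖ ≤ ‖f‖ := norm_quotientShift_le hh
  set c := starRingEnd ℂ (h w / h 0) with hc
  obtain ⟨m, hm⟩ := exists_tendsto_norm_pow hRle (kernel w)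
  -- Apply `Rⁿ` to the kernel identity, isolate `w̄ Rⁿ k_w`, and expand the squared norm.
  have hstep : ∀ n, ‖(R ^ (n + 1)) (kernel w)‖ ^ 2 -
      2 * (c * inner ℂ ((R ^ (n + 1)) (kernel w)) ((R ^ (n + 1)) (kernel 0))).re +
      ‖c‖ ^ 2 * ‖(R ^ (n + 1)) (kernel 0)‖ ^ 2 = ‖(w : ℂ)‖ ^ 2 * ‖(R ^ n) (kernel w)‖ ^ 2 := by
    intro n
    have h1 : (R ^ (n + 1)) (kernel w) - c • (R ^ (n + 1)) (kernel 0) =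
        starRingEnd ℂ (w : ℂ) • (R ^ n) (kernel w) := by
      rw [pow_succ]
      change (R ^ n) (R (kernel w)) - c • (R ^ n) (R (kernel 0)) = _
      rw [hR, quotientShift_kernel h0 w, ← hR, map_add, map_smul, map_smul, add_sub_cancel_right]
    have h2 := congrArg (fun x => ‖x‖ ^ 2) h1
    simp only [norm_smul, RCLike.norm_conj] at h2
    rw [mul_pow] at h2
    rw [← h2, norm_sub_sq (𝕜 := ℂ), inner_smul_right, norm_smul, mul_pow]
    rfl
  have ha' : Tendsto (fun n => inner ℂ ((R ^ (n + 1)) (kernel w)) ((R ^ (n + 1)) (kernel 0)))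
      atTop (𝓝 (a w)) := by
    have h1 := (Complex.continuous_conj.tendsto _).comp
      ((tendsto_add_atTop_iff_nat 1).2 (ha (kernel w)))
    rw [inner_kernel_right, RCLike.conj_conj] at h1
    refine h1.congr fun n => ?_
    exact inner_conj_symm _ _
  have hlim := (((((tendsto_add_atTop_iff_nat 1).2 hm).pow 2).sub
    (((Complex.continuous_re.tendsto _).comp (ha'.const_mul c)).const_mul 2)).add
    ((((tendsto_add_atTop_iff_nat 1).2 hl).pow 2).const_mul (‖c‖ ^ 2)))
  have heq := tendsto_nhds_unique (hlim.congr hstep) ((hm.pow 2).const_mul (‖(w : ℂ)‖ ^ 2))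
  have hcn : ‖c‖ = ‖h w / h 0‖ := RCLike.norm_conj _
  rw [hcn] at heq
  have hw := w.sq_norm_lt_one
  -- In the limit the identity reads `m² - 2 Re(c a(w)) + |c|² l² = |w|² m²`; discard `(1 - |w|²) m²
  -- ≥ 0`.
  nlinarith [mul_nonneg (sub_nonneg.2 hw.le) (sq_nonneg m)]

/-- Integrating the boundary form of the defect inequality bounds `l² / |h(0)|²` by a real part of a
multiple of `⟨h, a⟩`, and this inner product vanishes. -/
theorem tendsto_pow_quotientShift_one {h : H2} (hh : ‖h‖ = 1) (h0 : h 0 ≠ 0) :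
    Tendsto (fun n => ‖(quotientShift h ^ n) (kernel 0)‖) atTop (𝓝 0) := by
  set R := quotientShift h with hR
  have hRle : ∀ f, ‖R f‖ ≤ ‖f‖ := norm_quotientShift_le hh
  obtain ⟨a, ha⟩ := exists_tendsto_inner_pow_eq_inner hRle (kernel 0)
  obtain ⟨l, hl⟩ := exists_tendsto_norm_pow hRle (kernel 0)
  -- `Rh = 0`, so `⟨Rⁿ1, Rⁿh⟩` is already `0` for `n ≥ 1`.
  have hah : inner ℂ a h = (0 : ℂ) := by
    refine tendsto_nhds_unique (ha h) (tendsto_const_nhds.congr' ?_)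
    filter_upwards [eventually_ge_atTop 1] with n hn
    obtain ⟨m, rfl⟩ := Nat.exists_eq_add_of_le' hn
    have : (R ^ (m + 1)) h = 0 := by
      rw [pow_succ]
      change (R ^ m) (R h) = 0
      rw [hR, quotientShift_self hh, map_zero]
    rw [this, inner_zero_right]
  have hbd : ∀ᵐ x ∂arcLength, ‖bdry h x‖ ^ 2 * (‖h 0‖⁻¹ ^ 2 * l ^ 2) ≤
      2 * ((starRingEnd ℂ (h 0))⁻¹ * (starRingEnd ℂ (bdry h x) * bdry a x)).re := by
    filter_upwards [ae_tendsto_radial h, ae_tendsto_radial a] with x h1 h2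
    have h3 := (h1.norm.pow 2).mul_const (‖h 0‖⁻¹ ^ 2 * l ^ 2)
    have h4 := ((Complex.continuous_re.tendsto _).comp
      ((((Complex.continuous_conj.tendsto _).comp h1).mul h2).const_mul
        (starRingEnd ℂ (h 0))⁻¹)).const_mul 2
    refine le_of_tendsto_of_tendsto h3 h4 ?_
    filter_upwards [Ico_mem_nhdsLT (zero_lt_one (α := ℝ))] with r hr
    have h5 := norm_sq_mul_le_of_tendsto hh h0 ha hl (discPoint r hr x)
    have e1 : h (discPoint r hr x) = h.extend (r * expI x) := (H2.extend_coe _ _).symm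
    have e2 : a (discPoint r hr x) = a.extend (r * expI x) := (H2.extend_coe _ _).symm
    rw [e1, e2, norm_div, map_div₀] at h5
    simp only [Function.comp_apply]
    refine le_trans (le_of_eq ?_) (h5.trans (le_of_eq ?_))
    · rw [div_eq_mul_inv]; ring
    · rw [div_eq_inv_mul, mul_assoc]
  have hi : Integrable (fun x => starRingEnd ℂ (bdry h x) * bdry a x) arcLength := by
    refine (L2.integrable_inner (𝕜 := ℂ) (bdry h) (bdry a)).congr (Eventually.of_forall fun x => ?_)
    change inner ℂ (bdry h x) (bdry a x) = _
    rw [RCLike.inner_apply, mul_comm]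
  have hi' := hi.const_mul (starRingEnd ℂ (h 0))⁻¹
  have hmono := integral_mono_ae ((integrable_norm_sq_bdry h).mul_const _) (hi'.re.const_mul 2) hbd
  have hre : ∫ x, 2 * ((starRingEnd ℂ (h 0))⁻¹ *
      (starRingEnd ℂ (bdry h x) * bdry a x)).re ∂arcLength = 0 := by
    rw [integral_const_mul]
    have h6 := integral_re (𝕜 := ℂ) hi'
    rw [integral_const_mul, ← inner_eq_integral_bdry, ← inner_conj_symm, hah] at h6
    simp only [map_zero, mul_zero] at h6
    exact mul_eq_zero_of_right _ h6
  have hlhs : ∫ x, ‖bdry h x‖ ^ 2 * (‖h 0‖⁻¹ ^ 2 * l ^ 2) ∂arcLength = ‖h 0‖⁻¹ ^ 2 * l ^ 2 := by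
    rw [integral_mul_const, ← norm_sq_eq_integral_bdry, hh]
    ring
  rw [hlhs] at hmono
  have h7 : ‖h 0‖⁻¹ ^ 2 * l ^ 2 ≤ 0 := hmono.trans (le_of_eq hre)
  have h8 : 0 < ‖h 0‖⁻¹ ^ 2 := by
    have := norm_pos_iff.2 h0
    positivity
  have h9 : l ^ 2 ≤ 0 := by nlinarith
  have h10 : l = 0 := by nlinarith
  rwa [h10] at hl

/-- The operator `f ↦ S*(f - ⟨h, f⟩ h)` is strongly stable for every unit vector `h ∈ H²` with
`h(0) ≠ 0`. -/
theorem tendsto_pow_quotientShift {h : H2} (hh : ‖h‖ = 1) (h0 : h 0 ≠ 0) (f : H2) :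
    Tendsto (fun n => ‖(quotientShift h ^ n) f‖) atTop (𝓝 0) := by
  set R := quotientShift h with hR
  have hRle : ∀ f, ‖R f‖ ≤ ‖f‖ := norm_quotientShift_le hh
  have hk : ∀ w, Tendsto (fun n => ‖(R ^ n) (kernel w)‖) atTop (𝓝 0) := by
    intro w
    obtain ⟨m, hm⟩ := exists_tendsto_norm_pow hRle (kernel w)
    have h1 := tendsto_pow_quotientShift_one hh h0
    -- Once `Rⁿ1 → 0`, the kernel identity gives `m ≤ |w| m` with `|w| < 1`, forcing `m = 0`.
    have hle : m ≤ ‖(w : ℂ)‖ * m + ‖starRingEnd ℂ (h w / h 0)‖ * 0 := by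
      refine le_of_tendsto_of_tendsto' ((tendsto_add_atTop_iff_nat 1).2 hm)
        ((hm.const_mul ‖(w : ℂ)‖).add (((tendsto_add_atTop_iff_nat 1).2 h1).const_mul
          ‖starRingEnd ℂ (h w / h 0)‖)) fun n => ?_
      have h2 : (R ^ (n + 1)) (kernel w) = starRingEnd ℂ (w : ℂ) • (R ^ n) (kernel w) +
          starRingEnd ℂ (h w / h 0) • (R ^ (n + 1)) (kernel 0) := by
        rw [pow_succ]
        change (R ^ n) (R (kernel w)) = _ + _ • (R ^ n) (R (kernel 0))
        rw [hR, quotientShift_kernel h0 w, ← hR, map_add, map_smul, map_smul]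
      rw [h2]
      refine (norm_add_le _ _).trans (le_of_eq ?_)
      rw [norm_smul, norm_smul, RCLike.norm_conj]
    have hm0 : 0 ≤ m := ge_of_tendsto' hm fun n => norm_nonneg _
    have hw := w.norm_lt_one
    have : m = 0 := by nlinarith
    rwa [this] at hm
  let Z : Submodule ℂ H2 :=
    { carrier := {f | Tendsto (fun n => ‖(R ^ n) f‖) atTop (𝓝 0)}
      zero_mem' := by simp
      add_mem' := fun {f g} hf hg => by
        have hfg : Tendsto (fun n => ‖(R ^ n) f‖ + ‖(R ^ n) g‖) atTop (𝓝 0) := by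
          simpa using Tendsto.add hf hg
        change Tendsto (fun n => ‖(R ^ n) (f + g)‖) atTop (𝓝 0)
        refine squeeze_zero (fun n => norm_nonneg _) (fun n => ?_) hfg
        rw [map_add]
        exact norm_add_le _ _
      smul_mem' := fun c f hf => by
        have := Tendsto.const_mul ‖c‖ hf
        rw [mul_zero] at this
        refine this.congr fun n => ?_
        rw [map_smul, norm_smul] }
  -- `Z` contains every kernel, and a function orthogonal to all kernels vanishes at every point.
  have hZ : Z.topologicalClosure = ⊤ := by
    rw [Submodule.topologicalClosure_eq_top_iff, Submodule.eq_bot_iff]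
    intro g hg
    refine H2.ext fun w => ?_
    rw [← inner_kernel]
    exact (Submodule.mem_orthogonal _ _).1 hg _ (hk w)
  have hfZ : f ∈ closure (Z : Set H2) := by
    rw [← Submodule.topologicalClosure_coe, hZ]
    trivial
  rw [Metric.tendsto_atTop]
  intro ε hε
  obtain ⟨g, hg, hfg⟩ := Metric.mem_closure_iff.1 hfZ (ε / 2) (half_pos hε)
  obtain ⟨N, hN⟩ := Metric.tendsto_atTop.1 hg (ε / 2) (half_pos hε)
  refine ⟨N, fun n hn => ?_⟩
  have h1 := hN n hn
  rw [dist_zero_right, norm_norm] at h1 ⊢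
  have h2 := norm_pow_le hRle (f - g) n
  rw [← dist_eq_norm] at h2
  calc ‖(R ^ n) f‖ = ‖(R ^ n) (f - g) + (R ^ n) g‖ := by rw [← map_add, sub_add_cancel]
    _ ≤ ‖(R ^ n) (f - g)‖ + ‖(R ^ n) g‖ := norm_add_le _ _
    _ < ε := by linarith

end Stability

/-! ### Hitt's theorem on nearly invariant subspaces. -/

section Hitt

theorem coeff_backwardShift (f : H2) (n : ℕ) :
    H2.coeff (backwardShift f) n = H2.coeff f (n + 1) := by
  have h : f = shift (backwardShift f) + f 0 • kernel 0 := H2.ext fun z => by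
    rw [H2.add_apply, H2.smul_apply, shift_backwardShift_apply, kernel_zero_apply]
    ring
  conv_rhs => rw [h]
  rw [map_add, map_smul, lp.coeFn_add, lp.coeFn_smul, Pi.add_apply, Pi.smul_apply, coeff_kernel,
    coeff_shift_succ]
  simp

variable {M : Submodule ℂ H2}

/-- The normalized reproducing kernel at the origin of a closed subspace. -/
theorem exists_extremal [M.HasOrthogonalProjection] (hM : ∃ e ∈ M, e 0 ≠ 0) :
    ∃ h ∈ M, ‖h‖ = 1 ∧ h 0 ≠ 0 ∧ ∀ f ∈ M, f 0 = inner ℂ h f * h 0 := by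
  obtain ⟨e, heM, he0⟩ := hM
  set p : H2 := M.starProjection (kernel 0) with hp
  have hpM : p ∈ M := Submodule.starProjection_apply_mem _ _
  have hpf : ∀ f ∈ M, inner ℂ p f = f 0 := fun f hf => by
    rw [← inner_kernel, hp, Submodule.inner_starProjection_left_eq_right,
      Submodule.starProjection_eq_self_iff.2 hf]
  have hp0 : p ≠ 0 := fun h => he0 (by rw [← hpf e heM, h, inner_zero_left])
  have hpn : ‖p‖ ≠ 0 := norm_ne_zero_iff.2 hp0
  have hpn' : (‖p‖ : ℂ) ≠ 0 := by exact_mod_cast hpn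
  have hpp : p 0 = (‖p‖ : ℂ) ^ 2 := by
    rw [← hpf p hpM, inner_self_eq_norm_sq_to_K]
    rfl
  have hh0 : (((‖p‖⁻¹ : ℝ) : ℂ) • p) 0 = ‖p‖ := by
    rw [H2.smul_apply, hpp]
    push_cast
    field_simp
  refine ⟨((‖p‖⁻¹ : ℝ) : ℂ) • p, M.smul_mem _ hpM, ?_, ?_, fun f hf => ?_⟩
  · rw [norm_smul, Complex.norm_real, norm_inv, norm_norm, inv_mul_cancel₀ hpn]
  · rw [hh0]; exact hpn'
  · rw [hh0, inner_smul_left, hpf f hf, Complex.conj_ofReal]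
    push_cast
    field_simp

variable {h : H2}

theorem shift_quotientShift (h0 : ∀ f ∈ M, f 0 = inner ℂ h f * h 0) {f : H2} (hf : f ∈ M) :
    shift (quotientShift h f) = f - inner ℂ h f • h := by
  rw [quotientShift_apply, shift_backwardShift]
  rw [H2.sub_apply, H2.smul_apply, ← h0 f hf, sub_self]

theorem NearlyInvariant.quotientShift_mem (hM : NearlyInvariant M) (hhM : h ∈ M)
    (h0 : ∀ f ∈ M, f 0 = inner ℂ h f * h 0) {f : H2} (hf : f ∈ M) : quotientShift h f ∈ M := by
  refine hM _ ?_
  rw [shift_quotientShift h0 hf]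
  exact M.sub_mem hf (M.smul_mem _ hhM)

theorem NearlyInvariant.pow_quotientShift_mem (hM : NearlyInvariant M) (hhM : h ∈ M)
    (h0 : ∀ f ∈ M, f 0 = inner ℂ h f * h 0) {f : H2} (hf : f ∈ M) (n : ℕ) :
    (quotientShift h ^ n) f ∈ M := by
  induction n with
  | zero => simpa using hf
  | succ n ih =>
    rw [pow_succ']
    exact hM.quotientShift_mem hhM h0 ih

/-- The relation `‖f‖² = |⟨h, f⟩|² + ‖Rf‖²` telescopes, and the remainder `‖Rⁿf‖²` tends to `0` by
strong stability. -/
theorem NearlyInvariant.hasSum_norm_sq (hM : NearlyInvariant M) (hhM : h ∈ M) (hh : ‖h‖ = 1)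
    (hne : h 0 ≠ 0) (h0 : ∀ f ∈ M, f 0 = inner ℂ h f * h 0) {f : H2} (hf : f ∈ M) :
    HasSum (fun n => ‖(inner ℂ h ((quotientShift h ^ n) f) : ℂ)‖ ^ 2) (‖f‖ ^ 2) := by
  have hpart : ∀ n, ∑ k ∈ Finset.range n, ‖(inner ℂ h ((quotientShift h ^ k) f) : ℂ)‖ ^ 2 =
      ‖f‖ ^ 2 - ‖(quotientShift h ^ n) f‖ ^ 2 := by
    intro n
    induction n with
    | zero => simp
    | succ n ih =>
      have h1 := shift_quotientShift h0 (hM.pow_quotientShift_mem hhM h0 hf n)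
      have h2 := norm_sq_sub_inner_smul hh ((quotientShift h ^ n) f)
      rw [← h1, shift.norm_map] at h2
      rw [Finset.sum_range_succ, ih, pow_succ' (quotientShift h)]
      change _ = ‖f‖ ^ 2 - ‖quotientShift h ((quotientShift h ^ n) f)‖ ^ 2
      rw [h2]
      ring
  rw [hasSum_iff_tendsto_nat_of_nonneg (fun n => by positivity)]
  simp_rw [hpart]
  simpa using ((tendsto_pow_quotientShift hh hne f).pow 2).const_sub (‖f‖ ^ 2)

/-- Iterating `f = ⟨h, f⟩ h + S(Rf)` leaves the remainder `zⁿ (Rⁿf)(z)`. Contractivity of `R` and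
`|z| < 1` suffice to kill it; stability is not needed here. -/
theorem NearlyInvariant.hasSum_apply (hM : NearlyInvariant M) (hhM : h ∈ M) (hh : ‖h‖ = 1)
    (h0 : ∀ f ∈ M, f 0 = inner ℂ h f * h 0) {f : H2} (hf : f ∈ M) {q : H2}
    (hq : ∀ n, H2.coeff q n = inner ℂ h ((quotientShift h ^ n) f)) (z : 𝔻) :
    f z = h z * q z := by
  have hpart : ∀ n, ∑ k ∈ Finset.range n, h z * (H2.coeff q k * (z : ℂ) ^ k) =
      f z - (z : ℂ) ^ n * ((quotientShift h ^ n) f) z := by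
    intro n
    induction n with
    | zero => simp
    | succ n ih =>
      have h1 := shift_quotientShift h0 (hM.pow_quotientShift_mem hhM h0 hf n)
      have h2 : (z : ℂ) * (quotientShift h ((quotientShift h ^ n) f)) z =
          ((quotientShift h ^ n) f) z - inner ℂ h ((quotientShift h ^ n) f) * h z := by
        rw [← shift_apply, h1]
        rfl
      rw [Finset.sum_range_succ, ih, pow_succ' (quotientShift h)]
      change _ = f z - (z : ℂ) ^ (n + 1) * (quotientShift h ((quotientShift h ^ n) f)) z
      rw [pow_succ, mul_assoc, h2, hq]
      ring
  have hlim : Tendsto (fun n => (z : ℂ) ^ n * ((quotientShift h ^ n) f) z) atTop (𝓝 0) := by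
    refine squeeze_zero_norm (a := fun n => ‖(z : ℂ)‖ ^ n * (‖kernel z‖ * ‖f‖)) (fun n => ?_) ?_
    · rw [norm_mul, norm_pow]
      gcongr
      refine (norm_apply_le _ z).trans ?_
      gcongr
      exact norm_pow_le (norm_quotientShift_le hh) f n
    · simpa using (tendsto_pow_atTop_nhds_zero_of_lt_one (norm_nonneg _)
        z.norm_lt_one).mul_const (‖kernel z‖ * ‖f‖)
  have h3 := ((H2.hasSum_coeff q z).mul_left (h z)).tendsto_sum_nat
  simp_rw [hpart] at h3
  refine tendsto_nhds_unique ?_ h3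
  simpa using hlim.const_sub (f z)

/-- Hitt's theorem: a closed nearly `S*`-invariant subspace containing a function that does not
vanish at the origin is the isometric image, under multiplication by a function, of a closed
`S*`-invariant subspace. -/
theorem NearlyInvariant.exists_eq_mulSubmodule (hM : NearlyInvariant M)
    (hc : IsClosed (M : Set H2)) (hM0 : ∃ e ∈ M, e 0 ≠ 0) :
    ∃ (K : Submodule ℂ H2) (h : H2), IsClosed (K : Set H2) ∧ BackwardInvariant K ∧
      IsIsometricMultiplier h K ∧ M = mulSubmodule h K := by
  have : CompleteSpace M := hc.completeSpace_coe
  obtain ⟨h, hhM, hh, hne, h0⟩ := exists_extremal hM0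
  have hex : ∀ f : M, ∃ q : H2, ∀ n, H2.coeff q n = inner ℂ h ((quotientShift h ^ n) (f : H2)) :=
    fun f => H2.exists_of_coeff (hM.hasSum_norm_sq hhM hh hne h0 f.2).summable
  choose W hW using hex
  let V : M →ₗᵢ[ℂ] H2 :=
    { toFun := W
      map_add' := fun f g => H2.coeff_ext fun n => by
        rw [map_add, lp.coeFn_add, Pi.add_apply, hW, hW, hW, Submodule.coe_add, map_add,
          inner_add_right]
      map_smul' := fun c f => H2.coeff_ext fun n => by
        rw [map_smul, lp.coeFn_smul, Pi.smul_apply, hW, hW, Submodule.coe_smul, map_smul,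
          inner_smul_right]
        rfl
      norm_map' := fun f => by
        have h1 := (hM.hasSum_norm_sq hhM hh hne h0 f.2).tsum_eq
        have h2 : ‖W f‖ ^ 2 = ‖f‖ ^ 2 := by
          rw [H2.norm_sq_eq]
          simp_rw [hW]
          exact h1
        exact (sq_eq_sq₀ (norm_nonneg _) (norm_nonneg _)).1 h2 }
  have hmul : ∀ (f : M) (z : 𝔻), (f : H2) z = h z * V f z := fun f z =>
    hM.hasSum_apply hhM hh h0 f.2 (hW f) z
  refine ⟨LinearMap.range V.toLinearMap, h, ?_, ?_, ?_, le_antisymm ?_ ?_⟩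
  · have := V.isometry.isClosedEmbedding.isClosed_range
    simpa [LinearMap.coe_range] using this
  · rintro _ ⟨f, rfl⟩
    -- Dropping the first coefficient of `∑ ⟨h, Rⁿf⟩ zⁿ` gives the series attached to `Rf`.
    refine ⟨⟨quotientShift h f, hM.quotientShift_mem hhM h0 f.2⟩, H2.coeff_ext fun n => ?_⟩
    rw [coeff_backwardShift]
    change H2.coeff (W _) n = H2.coeff (W f) (n + 1)
    rw [hW, hW, pow_succ]
    rfl
  · rintro _ ⟨f, rfl⟩
    exact ⟨f, hmul f, (V.norm_map f).symm⟩
  · intro f hf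
    exact ⟨V ⟨f, hf⟩, ⟨⟨f, hf⟩, rfl⟩, hmul ⟨f, hf⟩⟩
  · rintro F ⟨_, ⟨f, rfl⟩, hF⟩
    have : F = f := H2.ext fun z => by rw [hF, hmul]; rfl
    rw [this]
    exact f.2

end Hitt

/-! ### Model spaces and near invariance of the closure of `gK`. -/

section ModelSpace

open Metric

theorem modelSpace_backwardInvariant (θ : ℂ → ℂ) : BackwardInvariant (modelSpace θ) := by
  intro f hf
  rw [modelSpace, Submodule.mem_orthogonal'] at hf ⊢
  rintro F ⟨k, -, hF⟩
  rw [inner_backwardShift_left]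
  refine hf _ ⟨shift k, trivial, fun z => ?_⟩
  rw [shift_apply, shift_apply, hF]
  ring

/-- Otherwise `1` would lie in the closure of `θH²`, where `|F(0)| ≤ |θ(0)| ‖F‖`. This forces
`|θ(0)| ≥ 1`, and the maximum principle makes `θ` constant. -/
theorem IsInner.exists_mem_modelSpace {θ : ℂ → ℂ} (hθ : IsInner θ)
    (hθc : ¬ ∃ c : ℂ, ∀ z ∈ ball (0 : ℂ) 1, θ z = c) : ∃ e ∈ modelSpace θ, e 0 ≠ 0 := by
  by_contra! hcon
  obtain ⟨U, hU, hb⟩ := hθ.exists_H2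
  set N := mulSubmodule (fun z : 𝔻 => θ z) ⊤ with hN
  have hmem : kernel 0 ∈ closure (N : Set H2) := by
    rw [← Submodule.topologicalClosure_coe, ← Submodule.orthogonal_orthogonal_eq_closure]
    refine (Submodule.mem_orthogonal _ _).2 fun e he => ?_
    rw [inner_kernel_right, hcon e he, map_zero]
  have hsub : (N : Set H2) ⊆ {F : H2 | ‖F 0‖ ≤ ‖θ 0‖ * ‖F‖} := by
    rintro F ⟨k, -, hF⟩
    have hn : ‖F‖ = ‖k‖ := norm_eq_of_unimodular hb fun z => by rw [hF, hU]
    have hk := norm_apply_le k 0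
    rw [norm_kernel_zero, one_mul] at hk
    have hF0 : F 0 = θ 0 * k 0 := by simpa using hF 0
    change ‖F 0‖ ≤ ‖θ 0‖ * ‖F‖
    rw [hF0, hn, norm_mul]
    gcongr
  have hclosed : IsClosed {F : H2 | ‖F 0‖ ≤ ‖θ 0‖ * ‖F‖} :=
    isClosed_le (continuous_eval 0).norm (by fun_prop)
  have h1 : ‖kernel 0 0‖ ≤ ‖θ 0‖ * ‖kernel 0‖ := closure_minimal hsub hclosed hmem
  rw [kernel_zero_apply, norm_kernel_zero, mul_one, norm_one] at h1
  have hmax : IsMaxOn (norm ∘ θ) (ball 0 1) 0 := fun z hz =>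
    (hθ.norm_le_one (Complex.UnitDisc.mk z (mem_ball_zero_iff.1 hz))).trans h1
  exact hθc ⟨θ 0, Complex.eqOn_of_isPreconnected_of_isMaxOn_norm
    (convex_ball (0 : ℂ) 1).isPreconnected isOpen_ball hθ.differentiableOn
    (mem_ball_self one_pos) hmax⟩

theorem nearlyInvariant_closure_mulSubmodule {g : ℂ → ℂ} (hg : IsHInfty g) (hg0 : g 0 ≠ 0)
    {K : Submodule ℂ H2} (hK : BackwardInvariant K) (hK0 : ∃ e ∈ K, e 0 ≠ 0) :
    NearlyInvariant (mulSubmodule (fun z => g z) K).topologicalClosure := by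
  obtain ⟨e, he, he0⟩ := hK0
  obtain ⟨E, hE⟩ := hg.exists_mul e
  have hE0 : E 0 ≠ 0 := by
    rw [hE, Complex.UnitDisc.coe_zero]
    exact mul_ne_zero hg0 he0
  -- A continuous left inverse of `S` on all of `H²` that maps `gK` into itself; `S*` alone need not
  -- preserve `gK`. Continuity carries invariance over to the closure.
  let Φ : H2 → H2 := fun F => backwardShift (F - (F 0 / E 0) • E)
  have hΦ : Continuous Φ :=
    backwardShift.continuous.comp
      (continuous_id.sub (((continuous_eval 0).div_const _).smul continuous_const))
  intro f hf
  have hmaps : Set.MapsTo Φ (mulSubmodule (fun z : 𝔻 => g z) K)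
      (mulSubmodule (fun z : 𝔻 => g z) K) := by
    rintro F ⟨k, hk, hF⟩
    set k' := k - (F 0 / E 0) • e with hk'
    have hk'K : k' ∈ K := K.sub_mem hk (K.smul_mem _ he)
    have hk'0 : k' 0 = 0 := by
      have hF0 : F 0 = g 0 * k 0 := by simpa using hF 0
      have hE0' : E 0 = g 0 * e 0 := by simpa using hE 0
      rw [hk', H2.sub_apply, H2.smul_apply, hF0, hE0', mul_div_mul_left _ _ hg0,
        div_mul_cancel₀ _ he0, sub_self]
    obtain ⟨G, hG⟩ := hg.exists_mul (backwardShift k')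
    refine ⟨backwardShift k', hK _ hk'K, fun z => ?_⟩
    have hs : F - (F 0 / E 0) • E = shift G := H2.ext fun z => by
      have h1 : (z : ℂ) * backwardShift k' z = k' z := by
        rw [← shift_apply, shift_backwardShift hk'0]
      rw [shift_apply, hG, mul_left_comm, h1, hk', H2.sub_apply, H2.sub_apply, H2.smul_apply,
        H2.smul_apply, hF z, hE z]
      ring
    change backwardShift (F - (F 0 / E 0) • E) z = _
    rw [hs, backwardShift_shift, hG]
  have h1 : Φ (shift f) ∈ closure (mulSubmodule (fun z : 𝔻 => g z) K : Set H2) :=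
    map_mem_closure hΦ hf hmaps
  have h2 : Φ (shift f) = f := by
    change backwardShift (shift f - (shift f 0 / E 0) • E) = f
    rw [shift_apply_zero, zero_div, zero_smul, sub_zero, backwardShift_shift]
  rwa [h2] at h1

end ModelSpace

end Hardy

end

theorem mainTheorem5 (g θ : ℂ → ℂ) (hg : Hardy.IsHInfty g) (hg0 : g 0 ≠ 0)
    (hθ : Hardy.IsInner θ) (hθc : ¬ ∃ c : ℂ, ∀ z ∈ Metric.ball (0 : ℂ) 1, θ z = c) :
    Hardy.NearlyInvariant
        (Hardy.mulSubmodule (fun z => g z) (Hardy.modelSpace θ)).topologicalClosure ∧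
      ∃ (K : Submodule ℂ Hardy.H2) (h : Hardy.H2),
        Hardy.BackwardInvariant K ∧
        ((∃ u : ℂ → ℂ, Hardy.IsInner u ∧ K = Hardy.modelSpace u) ∨ K = ⊤) ∧
        Hardy.IsIsometricMultiplier h K ∧
        (Hardy.mulSubmodule (fun z => g z) (Hardy.modelSpace θ)).topologicalClosure =
          Hardy.mulSubmodule h K := by
  have he := hθ.exists_mem_modelSpace hθc
  have hnear := Hardy.nearlyInvariant_closure_mulSubmodule hg hg0
    (Hardy.modelSpace_backwardInvariant θ) he
  refine ⟨hnear, ?_⟩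
  obtain ⟨e, heK, he0⟩ := he
  obtain ⟨E, hE⟩ := hg.exists_mul e
  have hE0 : E 0 ≠ 0 := by
    rw [hE, Complex.UnitDisc.coe_zero]
    exact mul_ne_zero hg0 he0
  -- `E = ge` supplies the element of the closure not vanishing at `0` that Hitt's theorem requires.
  obtain ⟨K, h, hc, hK, hiso, heq⟩ := hnear.exists_eq_mulSubmodule
    (Submodule.isClosed_topologicalClosure _)
    ⟨E, Submodule.le_topologicalClosure _ ⟨e, heK, hE⟩, hE0⟩
  exact ⟨K, h, hK, hK.eq_modelSpace hc, hiso, heq⟩
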